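/- Let $p$ be a prime and let $K$ be a field that is complete with respect to a non-archimedean absolute value $|\cdot|$ with $|p| = 1/p$. Let $\mathbb{A}$ be the rigid analytic affine line over $K$ with coordinate $x$, and let $X$ be an affinoid subdomain of $\mathbb{A}$. Equip the affinoid algebra $\mathcal{O}(X)$ with its supremum norm, or with any other complete submultiplicative non-archimedean $K$-algebra norm defining its affinoid Banach topology, let $\partial_x = d/dx : \mathcal{O}(X) \to \mathcal{O}(X)$, and let $$r(X) := \lim_{k\to\infty} \|\partial_x^k\|^{1/k}$$ be the spectral radius of the bounded operator $\partial_x$ on $\mathcal{O}(X)$. Let $r > r(X)$ be a real number in $\sqrt{|K^\times|}$, i.e. $r > 0$ and $r^n \in |K^\times|$ for some integer $n \geq 1$. Let $$\mathcal{D}_r(X) := \mathcal{O}(X)\langle \partial/r\rangle = \Big\{ \sum_{j \geq 0} a_j \partial^j \;:\; a_j \in \mathcal{O}(X),\ \lim_{j\to\infty} |a_j|\, r^j = 0 \Big\},$$ with the multiplication $$\Big(\sum_i u_i\partial^i\Big)\Big(\sum_j v_j \partial^j\Big) = \sum_{k \geq 0}\Big(\sum_{i \geq 0} u_i \sum_{\substack{0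 \le m \le i\\ k-i+m\ge 0}} \binom{i}{m}\, \partial_x^m(v_{k-i+m})\Big)\partial^k,$$ the unique continuous associative multiplication extending that of $\mathcal{O}(X)$ with $\partial^i\partial^j=\partial^{i+j}$, $a\cdot\partial^j = a\partial^j$ and $\partial a - a\partial = \partial_x(a)$ for $a\in\mathcal{O}(X)$. Then the ring $\mathcal{D}_r(X)$ is left and right Noetherian. -/

import Mathlib

open Filter Topology
open scoped ENNReal

set_option linter.unusedSectionVars false

universe u

namespace RigidLine

noncomputable section

/-! ### Tate algebras, affinoid algebras, affinoid subdomains of the affine line -/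

/-- The Tate algebra `K⟨T₁, …, Tₙ⟩` of power series whose coefficients tend to zero. -/
def TateAlgebra (K : Type u) [NontriviallyNormedField K] [IsUltrametricDist K] (n : ℕ) :
    Subalgebra K (MvPowerSeries (Fin n) K) where
  __ := MvPowerSeries.IsRestricted.subring (R := K) (fun _ : Fin n => (1 : ℝ))
  algebraMap_mem' c := MvPowerSeries.isRestricted_C (R := K) (fun _ : Fin n => (1 : ℝ)) c

/-- The Gauss norm on power series: the supremum of the norms of the coefficients. -/
def gaussNorm {K : Type u} [NontriviallyNormedField K] {n : ℕ} (f : MvPowerSeries (Fin n) K) : ℝ :=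
  ⨆ d : Fin n →₀ ℕ, ‖MvPowerSeries.coeff d f‖

/-- A complete normed commutative `K`-algebra is affinoid if it admits a surjective `K`-algebra
homomorphism from a Tate algebra that is bounded for the Gauss norm. -/
def IsAffinoid (K : Type u) [NontriviallyNormedField K] [IsUltrametricDist K]
    (A : Type u) [NormedCommRing A] [NormedAlgebra K A] [CompleteSpace A] : Prop :=
  ∃ (n : ℕ) (π : TateAlgebra K n →ₐ[K] A),
    Function.Surjective π ∧ ∃ C : ℝ, ∀ f : TateAlgebra K n,
      ‖π f‖ ≤ C * gaussNorm (f : MvPowerSeries (Fin n) K)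

/-- An element `b` of an affinoid algebra `B` is a morphism from `Sp B` to the affine line. This is
the image of that morphism, viewed as a Galois-stable set of points with coordinate in an algebraic
closure of `K`. (The points of `Sp B` are the Galois orbits of the `K`-algebra homomorphisms from
`B` to the algebraic closure.) -/
def image (K : Type u) [Field K] {B : Type u} [CommRing B] [Algebra K B] (b : B) :
    Set (AlgebraicClosure K) :=
  Set.range fun φ : B →ₐ[K] AlgebraicClosure K => φ b

/-- The morphism `Sp A ⟶ 𝔸¹` given by the element `x` of the affinoid algebra `A` is the inclusion
of an affinoid subdomain `X` with `𝒪(X) = A` and with `x` the restriction of the coordinate: every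
morphism `b : Sp B ⟶ 𝔸¹` from an affinoid space whose image is contained in the image of `x` factors
uniquely through `x`. (Every `K`-algebra homomorphism between affinoid algebras is continuous.) -/
def IsAffinoidSubdomain (K : Type u) [NontriviallyNormedField K] [IsUltrametricDist K]
    {A : Type u} [NormedCommRing A] [NormedAlgebra K A] [CompleteSpace A] (x : A) : Prop :=
  IsAffinoid K A ∧
    ∀ (B : Type u) [NormedCommRing B] [NormedAlgebra K B] [CompleteSpace B], IsAffinoid K B →
      ∀ b : B, image K b ⊆ image K x → ∃! φ : A →A[K] B, φ x = b

/-! ### The derivation `∂_x` -/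

section Derivative

variable {K : Type u} [NontriviallyNormedField K] [IsUltrametricDist K]

/-- The coefficient of `T₀ ^ j` in a power series in `T₀, …, Tₙ`. -/
def slice {n : ℕ} (j : ℕ) (f : MvPowerSeries (Fin (n + 1)) K) : MvPowerSeries (Fin n) K :=
  fun d => MvPowerSeries.coeff (Finsupp.cons j d) f

theorem coeff_slice {n : ℕ} (j : ℕ) (f : MvPowerSeries (Fin (n + 1)) K) (d : Fin n →₀ ℕ) :
    MvPowerSeries.coeff d (slice j f) = MvPowerSeries.coeff (Finsupp.cons j d) f := rfl

theorem cons_add_cons {n : ℕ} (i j : ℕ) (d e : Fin n →₀ ℕ) :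
    Finsupp.cons i d + Finsupp.cons j e = Finsupp.cons (i + j) (d + e) := by
  ext k
  refine Fin.cases ?_ (fun k => ?_) k <;> simp

theorem sum_antidiagonal_cons {n : ℕ} (j : ℕ) (d : Fin n →₀ ℕ)
    (F : (Fin (n + 1) →₀ ℕ) → (Fin (n + 1) →₀ ℕ) → K) :
    ∑ p ∈ Finset.HasAntidiagonal.antidiagonal (Finsupp.cons j d), F p.1 p.2 =
      ∑ s ∈ Finset.HasAntidiagonal.antidiagonal j, ∑ q ∈ Finset.HasAntidiagonal.antidiagonal d,
        F (Finsupp.cons s.1 q.1) (Finsupp.cons s.2 q.2) := by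
  classical
  rw [← Finset.sum_product']
  refine Finset.sum_nbij' (fun p => ((p.1 0, p.2 0), (p.1.tail, p.2.tail)))
    (fun s => (Finsupp.cons s.1.1 s.2.1, Finsupp.cons s.1.2 s.2.2)) ?_ ?_ ?_ ?_ ?_
  · rintro ⟨a, b⟩ h
    rw [Finset.HasAntidiagonal.mem_antidiagonal] at h
    simp only [Finset.mem_product, Finset.HasAntidiagonal.mem_antidiagonal] at h ⊢
    refine ⟨by rw [← Finsupp.add_apply, h, Finsupp.cons_zero], ?_⟩
    ext k
    have := DFunLike.congr_fun h k.succ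
    simpa [Finsupp.tail_apply] using this
  · rintro ⟨⟨a, b⟩, ⟨c, e⟩⟩ h
    simp only [Finset.mem_product, Finset.HasAntidiagonal.mem_antidiagonal] at h ⊢
    rw [cons_add_cons, h.1, h.2]
  · rintro ⟨a, b⟩ h
    simp [Finsupp.cons_tail]
  · rintro ⟨⟨a, b⟩, ⟨c, e⟩⟩ h
    simp [Finsupp.tail_cons]
  · rintro ⟨a, b⟩ h
    simp [Finsupp.cons_tail]

theorem slice_mul {n : ℕ} (j : ℕ) (f g : MvPowerSeries (Fin (n + 1)) K) :
    slice j (f * g) = ∑ s ∈ Finset.HasAntidiagonal.antidiagonal j, slice s.1 f * slice s.2 g := by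
  classical
  ext d
  rw [coeff_slice, MvPowerSeries.coeff_mul, map_sum]
  simp only [MvPowerSeries.coeff_mul, coeff_slice]
  exact sum_antidiagonal_cons j d
    (fun a b => MvPowerSeries.coeff a f * MvPowerSeries.coeff b g)

theorem mem_tate_iff {n : ℕ} (f : MvPowerSeries (Fin n) K) :
    f ∈ TateAlgebra K n ↔ Tendsto (fun d => ‖MvPowerSeries.coeff d f‖) cofinite (𝓝 0) := by
  change MvPowerSeries.IsRestricted _ f ↔ _
  simp [MvPowerSeries.IsRestricted, Finsupp.prod]

theorem slice_mem {n : ℕ} (j : ℕ) (f : TateAlgebra K (n + 1)) :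
    slice j (f : MvPowerSeries (Fin (n + 1)) K) ∈ TateAlgebra K n := by
  rw [mem_tate_iff]
  exact ((mem_tate_iff _).1 f.2).comp (Finsupp.cons_right_injective j).tendsto_cofinite

theorem norm_coeff_le {n : ℕ} (f : TateAlgebra K n) (d : Fin n →₀ ℕ) :
    ‖MvPowerSeries.coeff d (f : MvPowerSeries (Fin n) K)‖
      ≤ gaussNorm (f : MvPowerSeries (Fin n) K) := by
  refine le_ciSup (f := fun d => ‖MvPowerSeries.coeff d (f : MvPowerSeries (Fin n) K)‖) ?_ d
  have h := (mem_tate_iff _).1 f.2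
  have h1 := h.eventually (gt_mem_nhds zero_lt_one)
  have hfin : {d | ¬ ‖MvPowerSeries.coeff d (f : MvPowerSeries (Fin n) K)‖ < 1}.Finite := h1
  refine ((hfin.image fun d => ‖MvPowerSeries.coeff d (f : MvPowerSeries (Fin n) K)‖).bddAbove.union
    (bddAbove_Iic (a := (1 : ℝ)))).mono ?_
  rintro _ ⟨d, rfl⟩
  by_cases hd : ‖MvPowerSeries.coeff d (f : MvPowerSeries (Fin n) K)‖ < 1
  · exact Or.inr hd.le
  · exact Or.inl ⟨d, hd, rfl⟩

theorem gaussNorm_slice_le {n : ℕ} (j : ℕ) (f : TateAlgebra K (n + 1)) :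
    gaussNorm (slice j (f : MvPowerSeries (Fin (n + 1)) K))
      ≤ gaussNorm (f : MvPowerSeries (Fin (n + 1)) K) :=
  ciSup_le fun d => norm_coeff_le f (Finsupp.cons j d)

theorem gaussNorm_nonneg {n : ℕ} (f : MvPowerSeries (Fin n) K) : 0 ≤ gaussNorm f :=
  Real.iSup_nonneg fun _ => norm_nonneg _

/-- The power series `g₀ + g₁ T₀`. -/
def unslice {n : ℕ} (g₀ g₁ : MvPowerSeries (Fin n) K) : MvPowerSeries (Fin (n + 1)) K :=
  fun d => if d 0 = 0 then MvPowerSeries.coeff d.tail g₀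
    else if d 0 = 1 then MvPowerSeries.coeff d.tail g₁ else 0

theorem unslice_mem {n : ℕ} (g₀ g₁ : TateAlgebra K n) :
    unslice (g₀ : MvPowerSeries (Fin n) K) (g₁ : MvPowerSeries (Fin n) K)
      ∈ TateAlgebra K (n + 1) := by
  rw [mem_tate_iff, Metric.tendsto_nhds]
  intro ε hε
  have h0 := (Metric.tendsto_nhds.1 ((mem_tate_iff _).1 g₀.2)) ε hε
  have h1 := (Metric.tendsto_nhds.1 ((mem_tate_iff _).1 g₁.2)) ε hε
  rw [eventually_cofinite] at h0 h1 ⊢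
  refine ((h0.image (Finsupp.cons 0)).union (h1.image (Finsupp.cons 1))).subset ?_
  intro d hd
  have hc : MvPowerSeries.coeff d
      (unslice (g₀ : MvPowerSeries (Fin n) K) (g₁ : MvPowerSeries (Fin n) K)) =
      if d 0 = 0 then MvPowerSeries.coeff d.tail (g₀ : MvPowerSeries (Fin n) K)
      else if d 0 = 1 then MvPowerSeries.coeff d.tail (g₁ : MvPowerSeries (Fin n) K) else 0 := rfl
  rw [Set.mem_ofPred_eq, hc] at hd
  split_ifs at hd with h h'
  · refine Or.inl ⟨d.tail, hd, ?_⟩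
    have := Finsupp.cons_tail d
    rwa [h] at this
  · refine Or.inr ⟨d.tail, hd, ?_⟩
    have := Finsupp.cons_tail d
    rwa [h'] at this
  · simp [hε] at hd

variable {A : Type u} [NormedCommRing A] [NormedAlgebra K A] [CompleteSpace A]

/-- If `A` is affinoid, then so is the algebra of dual numbers `A[ε]`. -/
theorem IsAffinoid.trivSqZeroExt (hA : IsAffinoid K A) : IsAffinoid K (TrivSqZeroExt A A) := by
  obtain ⟨n, π, hs, C, hC⟩ := hA
  refine ⟨n + 1, ?_⟩
  let s : ℕ → TateAlgebra K (n + 1) → TateAlgebra K n := fun j f => ⟨slice j f.1, slice_mem j f⟩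
  have s_add : ∀ j f g, s j (f + g) = s j f + s j g := fun j f g => Subtype.ext rfl
  have s_mul0 : ∀ f g, s 0 (f * g) = s 0 f * s 0 g := fun f g => by
    refine Subtype.ext ?_
    change slice 0 (f.1 * g.1) = slice 0 f.1 * slice 0 g.1
    rw [slice_mul]; simp
  have s_mul1 : ∀ f g, s 1 (f * g) = s 0 f * s 1 g + s 1 f * s 0 g := fun f g => by
    refine Subtype.ext ?_
    change slice 1 (f.1 * g.1) = slice 0 f.1 * slice 1 g.1 + slice 1 f.1 * slice 0 g.1
    rw [slice_mul, Finset.Nat.sum_antidiagonal_eq_sum_range_succ_mk]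
    simp [Finset.sum_range_succ]
  have s_alg0 : ∀ c, s 0 (algebraMap K _ c) = algebraMap K _ c := fun c => by
    refine Subtype.ext ?_
    ext d
    classical
    change MvPowerSeries.coeff (Finsupp.cons 0 d) (MvPowerSeries.C c) =
      MvPowerSeries.coeff d (MvPowerSeries.C c)
    rw [MvPowerSeries.coeff_C, MvPowerSeries.coeff_C]
    have : Finsupp.cons 0 d = 0 ↔ d = 0 := by
      have := Finsupp.cons_ne_zero_iff (y := 0) (s := d); tauto
    simp [this]
  have s_alg1 : ∀ c, s 1 (algebraMap K _ c) = 0 := fun c => by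
    refine Subtype.ext ?_
    ext d
    classical
    change MvPowerSeries.coeff (Finsupp.cons 1 d) (MvPowerSeries.C c) = 0
    rw [MvPowerSeries.coeff_C, if_neg]
    exact Finsupp.cons_ne_zero_of_left one_ne_zero
  let P : TateAlgebra K (n + 1) → TrivSqZeroExt A A := fun f => (π (s 0 f), π (s 1 f))
  have P_alg : ∀ c, P (algebraMap K _ c) = algebraMap K _ c := fun c => by
    refine TrivSqZeroExt.ext ?_ ?_
    · change π (s 0 _) = _
      rw [s_alg0, AlgHom.commutes]; rfl
    · change π (s 1 _) = _
      rw [s_alg1, map_zero]; rfl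
  refine ⟨{ toFun := P, map_one' := ?_, map_mul' := ?_, map_zero' := ?_, map_add' := ?_,
            commutes' := P_alg }, ?_, 2 * |C|, ?_⟩
  · simpa using P_alg 1
  · intro f g
    refine TrivSqZeroExt.ext ?_ ?_
    · change π (s 0 _) = π (s 0 f) * π (s 0 g)
      rw [s_mul0, map_mul]
    · rw [TrivSqZeroExt.snd_mul, op_smul_eq_smul]
      change π (s 1 _) = π (s 0 f) * π (s 1 g) + π (s 0 g) * π (s 1 f)
      rw [s_mul1, map_add, map_mul, map_mul, mul_comm (π (s 1 f))]
  · simpa using P_alg 0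
  · intro f g
    refine TrivSqZeroExt.ext ?_ ?_
    · change π (s 0 _) = π (s 0 f) + π (s 0 g)
      rw [s_add, map_add]
    · change π (s 1 _) = π (s 1 f) + π (s 1 g)
      rw [s_add, map_add]
  · rintro ⟨a, b⟩
    obtain ⟨g₀, rfl⟩ := hs a
    obtain ⟨g₁, rfl⟩ := hs b
    refine ⟨⟨_, unslice_mem g₀ g₁⟩, ?_⟩
    refine TrivSqZeroExt.ext ?_ ?_
    · change π (s 0 _) = π g₀
      congr 1
      refine Subtype.ext ?_
      ext d
      change unslice g₀.1 g₁.1 (Finsupp.cons 0 d) = _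
      rw [unslice, if_pos (by simp), Finsupp.tail_cons]
    · change π (s 1 _) = π g₁
      congr 1
      refine Subtype.ext ?_
      ext d
      change unslice g₀.1 g₁.1 (Finsupp.cons 1 d) = _
      rw [unslice, if_neg (by simp), if_pos (by simp), Finsupp.tail_cons]
  · intro f
    change ‖P f‖ ≤ _
    rw [TrivSqZeroExt.norm_def]
    change ‖π (s 0 f)‖ + ‖π (s 1 f)‖ ≤ _
    have hC' : ∀ j, ‖π (s j f)‖ ≤ |C| * gaussNorm (f : MvPowerSeries (Fin (n + 1)) K) := fun j =>
      (hC _).trans ((mul_le_mul_of_nonneg_right (le_abs_self C) (gaussNorm_nonneg _)).trans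
        (mul_le_mul_of_nonneg_left (gaussNorm_slice_le j f) (abs_nonneg C)))
    calc ‖π (s 0 f)‖ + ‖π (s 1 f)‖
        ≤ |C| * gaussNorm (f : MvPowerSeries (Fin (n + 1)) K) +
          |C| * gaussNorm (f : MvPowerSeries (Fin (n + 1)) K) := add_le_add (hC' 0) (hC' 1)
      _ = 2 * |C| * gaussNorm (f : MvPowerSeries (Fin (n + 1)) K) := by ring

/-- On `X` there is exactly one continuous `K`-linear derivation of `𝒪(X)` with value `1` on the
coordinate `x`. -/
theorem IsAffinoidSubdomain.existsUnique_derivation {x : A} (hX : IsAffinoidSubdomain K x) :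
    ∃! δ : Derivation K A A, Continuous δ ∧ δ x = 1 := by
  have hid : ∀ φ : A →A[K] A, φ x = x → φ = ContinuousAlgHom.id K A := fun φ h =>
    (hX.2 A hX.1 x subset_rfl).unique h rfl
  have himg : image K (TrivSqZeroExt.inl x + TrivSqZeroExt.inr 1 : TrivSqZeroExt A A)
      ⊆ image K x := by
    rintro _ ⟨ψ, rfl⟩
    refine ⟨ψ.comp (TrivSqZeroExt.inlAlgHom K A A), ?_⟩
    have h : ψ (TrivSqZeroExt.inr 1) * ψ (TrivSqZeroExt.inr 1) = 0 := by
      rw [← map_mul, TrivSqZeroExt.inr_mul_inr, map_zero]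
    have h0 : ψ (TrivSqZeroExt.inr 1) = 0 := mul_self_eq_zero.1 h
    change ψ (TrivSqZeroExt.inl x) = ψ _
    rw [map_add, h0, add_zero]
  obtain ⟨φ, hφ, huniq⟩ := hX.2 (TrivSqZeroExt A A) hX.1.trivSqZeroExt _ himg
  have hfst : ∀ a, (φ a).fst = a := fun a => by
    have := hid (ContinuousAlgHom.mk
      ((TrivSqZeroExt.fstHom K A A).comp (φ : A →ₐ[K] TrivSqZeroExt A A))
      (TrivSqZeroExt.continuous_fst.comp φ.continuous)) (by
        change (φ x).fst = x
        rw [hφ]; simp)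
    exact DFunLike.congr_fun this a
  refine ⟨Derivation.mk' ((TrivSqZeroExt.sndHom A A).restrictScalars K ∘ₗ
      (φ : A →ₐ[K] TrivSqZeroExt A A).toLinearMap) ?_, ⟨?_, ?_⟩, ?_⟩
  · intro a b
    change (φ (a * b)).snd = a • (φ b).snd + b • (φ a).snd
    rw [map_mul, TrivSqZeroExt.snd_mul, hfst, hfst, op_smul_eq_smul]
  · exact TrivSqZeroExt.continuous_snd.comp φ.continuous
  · change (φ x).snd = 1
    rw [hφ]; simp
  · rintro δ ⟨hc, hδ⟩
    let ψ₀ : A →ₐ[K] TrivSqZeroExt A A := AlgHom.ofLinearMap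
      ((TrivSqZeroExt.inlAlgHom K A A).toLinearMap +
        (TrivSqZeroExt.inrHom A A).restrictScalars K ∘ₗ (δ : A →ₗ[K] A))
      (by refine TrivSqZeroExt.ext ?_ ?_ <;> simp)
      (by intro a b; refine TrivSqZeroExt.ext ?_ ?_ <;> simp [mul_comm])
    have hψ : Continuous ψ₀ := by
      change Continuous fun a => (TrivSqZeroExt.inl a + TrivSqZeroExt.inr (δ a) :
        TrivSqZeroExt A A)
      exact TrivSqZeroExt.continuous_inl.add (TrivSqZeroExt.continuous_inr.comp hc)
    have := huniq ⟨ψ₀, hψ⟩ (by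
      change (TrivSqZeroExt.inl x + TrivSqZeroExt.inr (δ x) : TrivSqZeroExt A A) = _
      rw [hδ])
    ext a
    change _ = (φ a).snd
    rw [← this]
    change _ = (TrivSqZeroExt.inl a + TrivSqZeroExt.inr (δ a) : TrivSqZeroExt A A).snd
    simp

/-- The derivation `∂_x = d/dx` of `𝒪(X)`. -/
def ddx {x : A} (hX : IsAffinoidSubdomain K x) : Derivation K A A :=
  hX.existsUnique_derivation.choose

theorem ddx_spec {x : A} (hX : IsAffinoidSubdomain K x) : Continuous (ddx hX) ∧ ddx hX x = 1 :=
  hX.existsUnique_derivation.choose_spec.1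

end Derivative

/-! ### Spectral radius and the skew-Tate algebra -/

section SkewTate

/-- The operator norm `sup_{a ≠ 0} ‖T a‖ / ‖a‖`, with values in `[0, ∞]`. -/
def opNorm {K : Type u} [NontriviallyNormedField K] {V : Type u} [NormedAddCommGroup V]
    [NormedSpace K V] (T : V →ₗ[K] V) : ℝ≥0∞ :=
  ⨆ a : V, ‖T a‖ₑ / ‖a‖ₑ

/-- The spectral radius `lim ‖T ^ k‖ ^ (1 / k)`. The limit exists for every bounded `T`, since
the operator norm is submultiplicative, so it equals the limit superior written here. -/
def opSpectralRadius {K : Type u} [NontriviallyNormedField K] {V : Type u}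
    [NormedAddCommGroup V] [NormedSpace K V] (T : V →ₗ[K] V) : ℝ≥0∞ :=
  limsup (fun k : ℕ => opNorm (T ^ k) ^ (1 / (k : ℝ))) atTop

variable {K : Type u} [NontriviallyNormedField K]
variable {A : Type u} [NormedCommRing A] [NormedAlgebra K A]

/-- `δ` is a bounded derivation whose spectral radius is less than `r`. -/
def IsAdmissible (δ : Derivation K A A) (r : ℝ) : Prop :=
  Continuous δ ∧ opSpectralRadius (δ : A →ₗ[K] A) < ENNReal.ofReal r

theorem IsAdmissible.pos {δ : Derivation K A A} {r : ℝ} (h : IsAdmissible δ r) : 0 < r :=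
  ENNReal.ofReal_pos.1 (lt_of_le_of_lt bot_le h.2)

theorem IsAdmissible.exists_bound {δ : Derivation K A A} {r : ℝ} (h : IsAdmissible δ r) :
    ∃ C : ℝ, 0 ≤ C ∧ ∀ (m : ℕ) (a : A), ‖δ^[m] a‖ ≤ C * r ^ m * ‖a‖ := by
  have hr := h.pos
  have hpow : ∀ (m : ℕ) (a : A), ((δ : A →ₗ[K] A) ^ m) a = δ^[m] a := fun m a => by
    rw [Module.End.pow_apply]; rfl
  obtain ⟨N, hN⟩ := eventually_atTop.1 (eventually_lt_of_limsup_lt h.2)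
  have hlarge : ∀ m, N ≤ m → 1 ≤ m → ∀ a : A, ‖δ^[m] a‖ ≤ r ^ m * ‖a‖ := by
    intro m hm hm1 a
    by_cases ha : a = 0
    · subst ha
      rw [← hpow]; simp
    have h1 : opNorm ((δ : A →ₗ[K] A) ^ m) ≤ ENNReal.ofReal r ^ m := by
      have := ENNReal.rpow_le_rpow (hN m hm).le (Nat.cast_nonneg (α := ℝ) m)
      rwa [← ENNReal.rpow_mul, one_div, inv_mul_cancel₀ (by positivity), ENNReal.rpow_one,
        ENNReal.rpow_natCast] at this
    have h2 : ‖δ^[m] a‖ₑ / ‖a‖ₑ ≤ ENNReal.ofReal r ^ m := by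
      refine le_trans ?_ h1
      rw [← hpow]
      exact le_iSup (fun a : A => ‖((δ : A →ₗ[K] A) ^ m) a‖ₑ / ‖a‖ₑ) a
    rw [ENNReal.div_le_iff (by simpa using ha) (by simp)] at h2
    rw [← ofReal_norm, ← ofReal_norm, ← ENNReal.ofReal_pow hr.le,
      ← ENNReal.ofReal_mul (by positivity)] at h2
    exact (ENNReal.ofReal_le_ofReal_iff (by positivity)).1 h2
  let D : A →L[K] A := ⟨(δ : A →ₗ[K] A), h.1⟩
  have hD : ∀ (m : ℕ) (a : A), (D ^ m) a = δ^[m] a := fun m a => by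
    rw [FunLike.coe_pow_eq_iterate]; rfl
  refine ⟨1 + ∑ m ∈ Finset.range (N + 1), ‖D ^ m‖ / r ^ m, by positivity, fun m a => ?_⟩
  by_cases hm : m < N + 1
  · have h1 : ‖δ^[m] a‖ ≤ ‖D ^ m‖ / r ^ m * r ^ m * ‖a‖ := by
      rw [div_mul_cancel₀ _ (by positivity), ← hD]
      exact (D ^ m).le_opNorm a
    refine h1.trans ?_
    gcongr
    have := Finset.single_le_sum (f := fun m => ‖D ^ m‖ / r ^ m)
      (fun i _ => by positivity) (Finset.mem_range.2 hm)
    linarith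
  · refine (hlarge m (by omega) (by omega) a).trans ?_
    gcongr
    have : (0 : ℝ) ≤ ∑ m ∈ Finset.range (N + 1), ‖D ^ m‖ / r ^ m := by positivity
    nlinarith [pow_pos hr m]

/-- Left multiplication by `∂` on formal series `∑ vₖ ∂ᵏ`, where `∂ a = a ∂ + δ(a)`. -/
def dmul (δ : Derivation K A A) (v : ℕ → A) : ℕ → A
  | 0 => δ (v 0)
  | k + 1 => v k + δ (v (k + 1))

/-- Left multiplication by `∂ⁱ` in closed form: the coefficient of `∂ᵏ` in `∂ⁱ (∑ vⱼ ∂ʲ)` is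
`∑ₘ binom(i, m) δᵐ(v_{k - i + m})`. -/
theorem dmul_iterate_apply (δ : Derivation K A A) (v : ℕ → A) (i k : ℕ) :
    (dmul δ)^[i] v k = ∑ m ∈ Finset.range (i + 1),
      if i ≤ k + m then (i.choose m : A) * δ^[m] (v (k + m - i)) else 0 := by
  let S : Module.End ℤ (ℕ → A) := AddMonoidHom.toIntLinearMap
    { toFun := fun v k => if 1 ≤ k then v (k - 1) else 0
      map_zero' := by ext k; simp
      map_add' := fun v w => by ext k; by_cases hk : 1 ≤ k <;> simp [hk] }
  let E : Module.End ℤ (ℕ → A) := AddMonoidHom.toIntLinearMap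
    { toFun := fun v k => δ (v k)
      map_zero' := by ext k; simp
      map_add' := fun v w => by ext k; simp }
  have hcomm : Commute E S := by
    refine LinearMap.ext fun v => funext fun k => ?_
    change δ (if 1 ≤ k then v (k - 1) else 0) = if 1 ≤ k then δ (v (k - 1)) else 0
    split_ifs <;> simp
  have hD : ∀ v, dmul δ v = (E + S) v := fun v => by
    ext k
    cases k with
    | zero =>
      change δ (v 0) = δ (v 0) + if 1 ≤ 0 then v (0 - 1) else 0
      simp
    | succ k =>
      change v k + δ (v (k + 1)) = δ (v (k + 1)) + if 1 ≤ k + 1 then v (k + 1 - 1) else 0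
      simp [add_comm]
  have hE : ∀ m v k, (E ^ m) v k = δ^[m] (v k) := by
    intro m
    induction m with
    | zero => intro v k; rfl
    | succ m ih => intro v k; rw [pow_succ, Module.End.mul_apply, ih]; rfl
  have hS : ∀ n v k, (S ^ n) v k = if n ≤ k then v (k - n) else 0 := by
    intro n
    induction n with
    | zero => intro v k; simp
    | succ n ih =>
      intro v k
      rw [pow_succ, Module.End.mul_apply, ih]
      change (if n ≤ k then (if 1 ≤ k - n then v (k - n - 1) else 0) else 0) = _
      by_cases h : n + 1 ≤ k
      · rw [if_pos (by omega), if_pos (by omega), if_pos h, Nat.sub_sub]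
      · rw [if_neg h]
        split_ifs <;> first | rfl | omega
  have hpow : (dmul δ)^[i] v = ((E + S) ^ i) v := by
    induction i with
    | zero => rfl
    | succ i ih => rw [Function.iterate_succ_apply', ih, hD, pow_succ', Module.End.mul_apply]
  rw [hpow, hcomm.add_pow, LinearMap.sum_apply, Finset.sum_apply]
  refine Finset.sum_congr rfl fun m hm => ?_
  have hm' : m ≤ i := by simpa [Nat.lt_succ_iff] using hm
  rw [← Nat.cast_comm, ← nsmul_eq_mul]
  change i.choose m • ((E ^ m * S ^ (i - m)) v k) = _
  rw [Module.End.mul_apply, hE, hS]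
  by_cases h : i ≤ k + m
  · rw [if_pos h, if_pos (by omega), nsmul_eq_mul, show k - (i - m) = k + m - i by omega]
  · rw [if_neg h, if_neg (by omega), iterate_map_zero, smul_zero]

/-- The elements of the skew-Tate algebra `A⟨∂/r⟩`: formal series `∑ aⱼ ∂ʲ` with
`‖aⱼ‖ rʲ → 0`, represented by their sequence of coefficients. -/
def SkewTate (δ : Derivation K A A) (r : ℝ) (_h : IsAdmissible δ r) : Type u :=
  {a : ℕ → A // Tendsto (fun j => ‖a j‖ * r ^ j) atTop (𝓝 0)}

namespace SkewTate

variable {δ : Derivation K A A} {r : ℝ} {h : IsAdmissible δ r}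

/-- The `j`-th coefficient. -/
def coeff (a : SkewTate δ r h) (j : ℕ) : A := a.1 j

@[ext] theorem ext {a b : SkewTate δ r h} (H : ∀ j, a.coeff j = b.coeff j) : a = b :=
  Subtype.ext (funext H)

theorem tendsto_coeff (a : SkewTate δ r h) :
    Tendsto (fun j => ‖a.coeff j‖ * r ^ j) atTop (𝓝 0) := a.2

/-- The coefficient sequences form an additive subgroup. -/
def addSubgroup (A : Type u) [NormedCommRing A] (r : ℝ) (hr : 0 < r) : AddSubgroup (ℕ → A) where
  carrier := {a | Tendsto (fun j => ‖a j‖ * r ^ j) atTop (𝓝 0)}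
  zero_mem' := by simp
  add_mem' := by
    intro a b ha hb
    refine squeeze_zero (fun j => by positivity) (fun j => ?_) (by simpa using ha.add hb)
    rw [← add_mul]
    exact mul_le_mul_of_nonneg_right (norm_add_le _ _) (by positivity)
  neg_mem' := by
    intro a ha
    simpa using ha

instance : AddCommGroup (SkewTate δ r h) :=
  inferInstanceAs (AddCommGroup (addSubgroup A r h.pos))

@[simp] theorem coeff_add (a b : SkewTate δ r h) (j : ℕ) :
    (a + b).coeff j = a.coeff j + b.coeff j := rfl
@[simp] theorem coeff_zero (j : ℕ) : (0 : SkewTate δ r h).coeff j = 0 := rfl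

instance : One (SkewTate δ r h) :=
  ⟨⟨fun j => if j = 0 then 1 else 0, tendsto_const_nhds.congr' (by
    filter_upwards [eventually_gt_atTop 0] with j hj
    simp [hj.ne'])⟩⟩

theorem coeff_one (j : ℕ) : (1 : SkewTate δ r h).coeff j = if j = 0 then 1 else 0 := rfl

theorem exists_coeff_bound (a : SkewTate δ r h) :
    ∃ V : ℝ, 0 ≤ V ∧ ∀ j, ‖a.coeff j‖ * r ^ j ≤ V := by
  obtain ⟨V, hV⟩ := a.tendsto_coeff.bddAbove_range
  have hr := h.pos
  exact ⟨V, le_trans (by positivity) (hV ⟨0, rfl⟩), fun j => hV ⟨j, rfl⟩⟩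

/-- Left multiplication by `∂`. -/
def D (v : SkewTate δ r h) : SkewTate δ r h := ⟨dmul δ v.coeff, by
  obtain ⟨C, hC0, hC⟩ := h.exists_bound
  have hr := h.pos
  rw [← tendsto_add_atTop_iff_nat 1]
  have h1 := (v.tendsto_coeff.mul_const r).add
    (((tendsto_add_atTop_iff_nat 1).2 v.tendsto_coeff).const_mul (C * r))
  rw [zero_mul, mul_zero, zero_add] at h1
  refine squeeze_zero (fun j => by positivity) (fun j => ?_) h1
  have h2 : ‖δ (v.coeff (j + 1))‖ ≤ C * r * ‖v.coeff (j + 1)‖ := by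
    simpa using hC 1 (v.coeff (j + 1))
  calc ‖v.coeff j + δ (v.coeff (j + 1))‖ * r ^ (j + 1)
      ≤ (‖v.coeff j‖ + C * r * ‖v.coeff (j + 1)‖) * r ^ (j + 1) := by
        gcongr; exact (norm_add_le _ _).trans (by gcongr)
    _ = _ := by ring⟩

theorem coeff_D_zero (v : SkewTate δ r h) : (D v).coeff 0 = δ (v.coeff 0) := rfl
theorem coeff_D_succ (v : SkewTate δ r h) (k : ℕ) :
    (D v).coeff (k + 1) = v.coeff k + δ (v.coeff (k + 1)) := rfl

theorem coeff_D_iterate (v : SkewTate δ r h) (i k : ℕ) :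
    (D^[i] v).coeff k = (dmul δ)^[i] v.coeff k := by
  have : ∀ v : SkewTate δ r h, (D^[i] v).coeff = (dmul δ)^[i] v.coeff := by
    induction i with
    | zero => intro v; rfl
    | succ i ih => intro v; rw [Function.iterate_succ_apply, ih]; rfl
  exact congrFun (this v) k

variable [IsUltrametricDist A]

theorem D_iterate_bound {C V : ℝ} (hC : ∀ (m : ℕ) (a : A), ‖δ^[m] a‖ ≤ C * r ^ m * ‖a‖)
    (hC0 : 0 ≤ C) (v : SkewTate δ r h) (hV : ∀ j, ‖v.coeff j‖ * r ^ j ≤ V) (i : ℕ) :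
    ∀ m k, ‖δ^[m] ((D^[i] v).coeff k)‖ * r ^ k ≤ C * r ^ (m + i) * V := by
  have hr := h.pos
  have hadd : ∀ m (a b : A), δ^[m] (a + b) = δ^[m] a + δ^[m] b := fun m a b =>
    iterate_map_add δ m a b
  induction i with
  | zero =>
    intro m k
    calc ‖δ^[m] (v.coeff k)‖ * r ^ k ≤ C * r ^ m * ‖v.coeff k‖ * r ^ k := by gcongr; exact hC _ _
      _ = C * r ^ m * (‖v.coeff k‖ * r ^ k) := by ring
      _ ≤ _ := mul_le_mul_of_nonneg_left (hV k) (by positivity)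
  | succ i ih =>
    intro m k
    rw [Function.iterate_succ_apply']
    have h1 : ∀ k, ‖δ^[m] (δ ((D^[i] v).coeff k))‖ * r ^ k ≤ C * r ^ (m + (i + 1)) * V := by
      intro k
      have := ih (m + 1) k
      rw [Function.iterate_succ_apply] at this
      rwa [show m + (i + 1) = m + 1 + i by ring]
    cases k with
    | zero => exact h1 0
    | succ k =>
      rw [coeff_D_succ, hadd]
      refine (mul_le_mul_of_nonneg_right (IsUltrametricDist.norm_add_le_max _ _)
        (by positivity)).trans ?_
      rw [max_mul_of_nonneg _ _ (by positivity)]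
      refine max_le ?_ (h1 (k + 1))
      calc ‖δ^[m] ((D^[i] v).coeff k)‖ * r ^ (k + 1)
          = (‖δ^[m] ((D^[i] v).coeff k)‖ * r ^ k) * r := by ring
        _ ≤ C * r ^ (m + i) * V * r := mul_le_mul_of_nonneg_right (ih m k) hr.le
        _ = _ := by ring

theorem exists_iterate_bound (v : SkewTate δ r h) :
    ∃ W : ℝ, 0 ≤ W ∧ ∀ i k, ‖(D^[i] v).coeff k‖ * r ^ k ≤ W * r ^ i := by
  obtain ⟨C, hC0, hC⟩ := h.exists_bound
  obtain ⟨V, hV0, hV⟩ := v.exists_coeff_bound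
  refine ⟨C * V, by positivity, fun i k => ?_⟩
  have := D_iterate_bound hC hC0 v hV i 0 k
  rw [zero_add] at this
  calc _ ≤ _ := this
    _ = _ := by ring

theorem term_bound (u v : SkewTate δ r h) {W : ℝ}
    (hW : ∀ i k, ‖(D^[i] v).coeff k‖ * r ^ k ≤ W * r ^ i) (i k : ℕ) :
    ‖u.coeff i * (D^[i] v).coeff k‖ * r ^ k ≤ ‖u.coeff i‖ * r ^ i * W := by
  have hr := h.pos
  calc ‖u.coeff i * (D^[i] v).coeff k‖ * r ^ k
      ≤ ‖u.coeff i‖ * ‖(D^[i] v).coeff k‖ * r ^ k := by gcongr; exact norm_mul_le _ _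
    _ = ‖u.coeff i‖ * (‖(D^[i] v).coeff k‖ * r ^ k) := by ring
    _ ≤ ‖u.coeff i‖ * (W * r ^ i) := mul_le_mul_of_nonneg_left (hW i k) (norm_nonneg _)
    _ = _ := by ring

variable [CompleteSpace A]

theorem summable_term (u v : SkewTate δ r h) (k : ℕ) :
    Summable fun i => u.coeff i * (D^[i] v).coeff k := by
  have hr := h.pos
  obtain ⟨W, hW0, hW⟩ := v.exists_iterate_bound
  refine NonarchimedeanAddGroup.summable_of_tendsto_cofinite_zero ?_
  rw [Nat.cofinite_eq_atTop]
  have h1 := (u.tendsto_coeff.mul_const W).mul_const ((r ^ k)⁻¹)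
  rw [zero_mul, zero_mul] at h1
  refine squeeze_zero_norm (fun i => ?_) h1
  rw [← div_eq_mul_inv, le_div_iff₀ (by positivity)]
  exact term_bound u v hW i k

/-- The star product: `(∑ uᵢ ∂ⁱ) v = ∑ uᵢ (∂ⁱ v)`, computed coefficientwise. -/
instance : Mul (SkewTate δ r h) :=
  ⟨fun u v => ⟨fun k => ∑' i, u.coeff i * (dmul δ)^[i] v.coeff k, by
    have hr := h.pos
    simp_rw [← coeff_D_iterate]
    obtain ⟨W, hW0, hW⟩ := v.exists_iterate_bound
    rw [Metric.tendsto_nhds]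
    intro ε hε
    have h1 := u.tendsto_coeff.mul_const W
    rw [zero_mul] at h1
    obtain ⟨N, hN⟩ := eventually_atTop.1 (h1.eventually (gt_mem_nhds (half_pos hε)))
    have h2 : ∀ᶠ k in atTop, ∀ i ∈ Finset.range N,
        ‖u.coeff i‖ * (‖(D^[i] v).coeff k‖ * r ^ k) < ε / 2 := by
      rw [Filter.eventually_all_finset]
      intro i _
      have := (D^[i] v).tendsto_coeff.const_mul ‖u.coeff i‖
      rw [mul_zero] at this
      exact this.eventually (gt_mem_nhds (half_pos hε))
    filter_upwards [h2] with k hk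
    rw [Real.dist_0_eq_abs, abs_of_nonneg (by positivity)]
    refine lt_of_le_of_lt ?_ (half_lt_self hε)
    rw [← le_div_iff₀ (by positivity)]
    refine IsUltrametricDist.norm_tsum_le_of_forall_le_of_nonneg (by positivity) fun i => ?_
    rw [le_div_iff₀ (by positivity)]
    by_cases hi : i < N
    · refine le_trans ?_ (hk i (Finset.mem_range.2 hi)).le
      rw [← mul_assoc]
      gcongr
      exact norm_mul_le _ _
    · exact (term_bound u v hW i k).trans (hN i (by omega)).le⟩⟩

theorem coeff_mul' (u v : SkewTate δ r h) (k : ℕ) :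
    (u * v).coeff k = ∑' i, u.coeff i * (dmul δ)^[i] v.coeff k := rfl

theorem coeff_mul (u v : SkewTate δ r h) (k : ℕ) :
    (u * v).coeff k = ∑' i, u.coeff i * (D^[i] v).coeff k := by
  simp_rw [coeff_mul', coeff_D_iterate]

theorem D_add (v w : SkewTate δ r h) : D (v + w) = D v + D w := by
  ext k
  cases k with
  | zero => simp [coeff_D_zero]
  | succ k => simp [coeff_D_succ]; abel

theorem D_iterate_add (i : ℕ) (v w : SkewTate δ r h) : D^[i] (v + w) = D^[i] v + D^[i] w := by
  induction i generalizing v w with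
  | zero => rfl
  | succ i ih => rw [Function.iterate_succ_apply, D_add, ih]; rfl

theorem add_mul' (u v w : SkewTate δ r h) : (u + v) * w = u * w + v * w := by
  ext k
  rw [coeff_add, coeff_mul, coeff_mul, coeff_mul,
    ← (summable_term u w k).tsum_add (summable_term v w k)]
  simp_rw [coeff_add, add_mul]

theorem mul_add' (u v w : SkewTate δ r h) : u * (v + w) = u * v + u * w := by
  ext k
  rw [coeff_add, coeff_mul, coeff_mul, coeff_mul,
    ← (summable_term u v k).tsum_add (summable_term u w k)]
  simp_rw [D_iterate_add, coeff_add, mul_add]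

/-- Right multiplication by `∂`. -/
def shift (v : SkewTate δ r h) : SkewTate δ r h :=
  ⟨fun k => Nat.casesOn k 0 fun k => v.coeff k, by
    rw [← tendsto_add_atTop_iff_nat 1]
    have h1 := v.tendsto_coeff.mul_const r
    rw [zero_mul] at h1
    refine h1.congr fun j => ?_
    change _ = ‖v.coeff j‖ * r ^ (j + 1)
    ring⟩

/-- Coefficientwise application of `δ`. -/
def der (v : SkewTate δ r h) : SkewTate δ r h :=
  ⟨fun k => δ (v.coeff k), by
    obtain ⟨C, hC0, hC⟩ := h.exists_bound
    have hr := h.pos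
    have h1 := v.tendsto_coeff.const_mul (C * r)
    rw [mul_zero] at h1
    refine squeeze_zero (fun j => by positivity) (fun j => ?_) h1
    rw [← mul_assoc]
    have h2 : ‖δ (v.coeff j)‖ ≤ C * r * ‖v.coeff j‖ := by simpa using hC 1 (v.coeff j)
    gcongr⟩

theorem D_eq (v : SkewTate δ r h) : D v = shift v + der v := by
  ext k
  cases k with
  | zero => exact (zero_add _).symm
  | succ k => rfl

theorem shift_mul (v w : SkewTate δ r h) : shift v * w = v * D w := by
  ext k
  rw [coeff_mul, coeff_mul, (summable_term (shift v) w k).tsum_eq_zero_add]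
  have h0 : (shift v).coeff 0 = 0 := rfl
  rw [h0, zero_mul, zero_add]
  rfl

theorem D_mul (v w : SkewTate δ r h) : D (v * w) = D v * w := by
  rw [D_eq v, add_mul', shift_mul]
  have hL : ∀ k, δ ((v * w).coeff k) =
      (der v * w).coeff k + ∑' i, v.coeff i * δ ((D^[i] w).coeff k) ∧
      Summable fun i => v.coeff i * δ ((D^[i] w).coeff k) := by
    intro k
    have h1 := ((summable_term v w k).hasSum.map (δ : A →+ A) h.1)
    have h2 := summable_term (der v) w k
    have h3 : ∀ i, ((δ : A →+ A) ∘ fun i => v.coeff i * (D^[i] w).coeff k) i -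
        (der v).coeff i * (D^[i] w).coeff k = v.coeff i * δ ((D^[i] w).coeff k) := by
      intro i
      change δ (v.coeff i * (D^[i] w).coeff k) - δ (v.coeff i) * (D^[i] w).coeff k = _
      rw [Derivation.leibniz, smul_eq_mul, smul_eq_mul]
      ring
    have h4 := h1.sub h2.hasSum
    simp_rw [h3] at h4
    refine ⟨?_, h4.summable⟩
    rw [h4.tsum_eq, coeff_mul, coeff_mul]
    change _ = _ + (δ (∑' i, v.coeff i * (D^[i] w).coeff k) - _)
    abel
  ext k
  rw [coeff_add]
  cases k with
  | zero =>
    rw [coeff_D_zero, (hL 0).1, add_comm, coeff_mul v]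
    congr 1
    refine tsum_congr fun i => ?_
    change _ = v.coeff i * (D^[i + 1] w).coeff 0
    rw [Function.iterate_succ_apply', coeff_D_zero]
  | succ k =>
    rw [coeff_D_succ, (hL (k + 1)).1, add_comm, add_assoc, add_comm, coeff_mul v w, coeff_mul v,
      add_comm (∑' i, _), ← (summable_term v w k).tsum_add (hL (k + 1)).2]
    congr 1
    refine tsum_congr fun i => ?_
    change _ = v.coeff i * (D^[i + 1] w).coeff (k + 1)
    rw [Function.iterate_succ_apply', coeff_D_succ, mul_add]

theorem D_iterate_mul (i : ℕ) (v w : SkewTate δ r h) : D^[i] (v * w) = D^[i] v * w := by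
  induction i with
  | zero => rfl
  | succ i ih => rw [Function.iterate_succ_apply', ih, D_mul, Function.iterate_succ_apply']

theorem mul_assoc' (u v w : SkewTate δ r h) : u * v * w = u * (v * w) := by
  have hr := h.pos
  ext k
  obtain ⟨W, hW0, hW⟩ := w.exists_iterate_bound
  obtain ⟨V, hV0, hV⟩ := v.exists_iterate_bound
  let F : ℕ → ℕ → A := fun i j => u.coeff i * (D^[i] v).coeff j * (D^[j] w).coeff k
  have hF : ∀ i j, ‖F i j‖ * r ^ k ≤ ‖u.coeff i‖ * (‖(D^[i] v).coeff j‖ * r ^ j) * W := by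
    intro i j
    calc ‖F i j‖ * r ^ k
        ≤ ‖u.coeff i‖ * ‖(D^[i] v).coeff j‖ * ‖(D^[j] w).coeff k‖ * r ^ k := by
          gcongr
          exact (norm_mul_le _ _).trans (by gcongr; exact norm_mul_le _ _)
      _ = ‖u.coeff i‖ * ‖(D^[i] v).coeff j‖ * (‖(D^[j] w).coeff k‖ * r ^ k) := by ring
      _ ≤ ‖u.coeff i‖ * ‖(D^[i] v).coeff j‖ * (W * r ^ j) :=
          mul_le_mul_of_nonneg_left (hW j k) (by positivity)
      _ = _ := by ring
  have hsum : Summable (Function.uncurry F) := by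
    refine NonarchimedeanAddGroup.summable_of_tendsto_cofinite_zero ?_
    rw [tendsto_zero_iff_norm_tendsto_zero, Metric.tendsto_nhds]
    intro ε hε
    have hε' : 0 < ε * r ^ k := by positivity
    have h1 := (u.tendsto_coeff.mul_const V).mul_const W
    rw [zero_mul, zero_mul] at h1
    obtain ⟨N, hN⟩ := eventually_atTop.1 (h1.eventually (gt_mem_nhds hε'))
    have h2 : ∀ᶠ j in atTop, ∀ i ∈ Finset.range N,
        ‖u.coeff i‖ * (‖(D^[i] v).coeff j‖ * r ^ j) * W < ε * r ^ k := by
      rw [Filter.eventually_all_finset]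
      intro i _
      have := ((D^[i] v).tendsto_coeff.const_mul ‖u.coeff i‖).mul_const W
      rw [mul_zero, zero_mul] at this
      exact this.eventually (gt_mem_nhds hε')
    obtain ⟨M, hM⟩ := eventually_atTop.1 h2
    rw [eventually_cofinite]
    refine (Finset.finite_toSet (Finset.range N ×ˢ Finset.range M)).subset ?_
    rintro ⟨i, j⟩ hij
    by_contra hn
    refine hij ?_
    rw [Real.dist_0_eq_abs, abs_of_nonneg (norm_nonneg _)]
    refine lt_of_mul_lt_mul_right ((hF i j).trans_lt ?_) (pow_pos hr k).le
    by_cases hi : i < N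
    · have hj : M ≤ j := by
        by_contra hj
        exact hn (by simp; omega)
      exact hM j hj i (Finset.mem_range.2 hi)
    · refine lt_of_le_of_lt ?_ (hN i (by omega))
      have : ‖u.coeff i‖ * (‖(D^[i] v).coeff j‖ * r ^ j) ≤ ‖u.coeff i‖ * (V * r ^ i) :=
        mul_le_mul_of_nonneg_left (hV i j) (norm_nonneg _)
      calc _ ≤ ‖u.coeff i‖ * (V * r ^ i) * W := mul_le_mul_of_nonneg_right this hW0
        _ = _ := by ring
  have hL : (u * v * w).coeff k = ∑' j, ∑' i, F i j := by
    rw [coeff_mul]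
    refine tsum_congr fun j => ?_
    rw [coeff_mul, (summable_term u v j).tsum_mul_right]
  have hR : (u * (v * w)).coeff k = ∑' i, ∑' j, F i j := by
    rw [coeff_mul]
    refine tsum_congr fun i => ?_
    rw [D_iterate_mul, coeff_mul, ← (summable_term (D^[i] v) w k).tsum_mul_left]
    exact tsum_congr fun j => (mul_assoc _ _ _).symm
  rw [hL, hR, hsum.tsum_comm]

theorem one_mul' (v : SkewTate δ r h) : 1 * v = v := by
  ext k
  rw [coeff_mul, tsum_eq_single 0]
  · simp [coeff_one]
  · intro i hi
    simp [coeff_one, hi]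

theorem coeff_D_iterate_one (i k : ℕ) :
    (D^[i] (1 : SkewTate δ r h)).coeff k = if k = i then 1 else 0 := by
  induction i generalizing k with
  | zero => rfl
  | succ i ih =>
    rw [Function.iterate_succ_apply']
    cases k with
    | zero => rw [coeff_D_zero, ih]; split_ifs <;> simp_all
    | succ k =>
      rw [coeff_D_succ, ih, ih]
      have : δ (if k + 1 = i then 1 else 0) = 0 := by split_ifs <;> simp
      rw [this]; simp

theorem mul_one' (v : SkewTate δ r h) : v * 1 = v := by
  ext k
  rw [coeff_mul, tsum_eq_single k]
  · simp [coeff_D_iterate_one]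
  · intro i hi
    rw [coeff_D_iterate_one, if_neg hi.symm, mul_zero]

/-- The skew-Tate algebra `A⟨∂/r⟩` with the star product is an associative unital ring. -/
instance : Ring (SkewTate δ r h) where
  __ := (inferInstance : AddCommGroup (SkewTate δ r h))
  __ := (inferInstance : Mul (SkewTate δ r h))
  __ := (inferInstance : One (SkewTate δ r h))
  mul_assoc := mul_assoc'
  one_mul := one_mul'
  mul_one := mul_one'
  left_distrib := mul_add'
  right_distrib := add_mul'
  zero_mul u := by
    have := add_mul' 0 0 u
    rwa [add_zero, left_eq_add] at this
  mul_zero u := by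
    have := mul_add' u 0 0
    rwa [add_zero, left_eq_add] at this
  zsmul_zero' := SubNegMonoid.zsmul_zero'
  zsmul_succ' := SubNegMonoid.zsmul_succ'
  zsmul_neg' := SubNegMonoid.zsmul_neg'

end SkewTate

end SkewTate

/-! ### The algebra of infinite-order differential operators -/

section DiffOp

variable {K : Type u} [NontriviallyNormedField K] [IsUltrametricDist K]
variable {A : Type u} [NormedCommRing A] [NormedAlgebra K A] [CompleteSpace A]

/-- The spectral radius `r(X)` of the affinoid subdomain `X`: the spectral radius of `∂_x` acting
on the Banach space `𝒪(X)`. -/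
def radius {x : A} (hX : IsAffinoidSubdomain K x) : ℝ≥0∞ :=
  opSpectralRadius (ddx hX : A →ₗ[K] A)

theorem isAdmissible_ddx {x : A} (hX : IsAffinoidSubdomain K x) {r : ℝ}
    (hr : radius hX < ENNReal.ofReal r) : IsAdmissible (ddx hX) r :=
  ⟨(ddx_spec hX).1, hr⟩

/-- The algebra `𝒟_r(X) = 𝒪(X)⟨∂/r⟩` for `r > r(X)`, formed with the derivation `∂_x`. -/
abbrev DiffOp {x : A} (hX : IsAffinoidSubdomain K x) (r : ℝ)
    (hr : radius hX < ENNReal.ofReal r) : Type u :=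
  SkewTate (ddx hX) r (isAdmissible_ddx hX hr)

/-- The divisible closure `√|Kˣ|` of the value group of `K` in the positive reals. -/
def sqrtValueGroup (K : Type u) [NontriviallyNormedField K] : Set ℝ :=
  {r | 0 < r ∧ ∃ n : ℕ, 0 < n ∧ ∃ c : K, c ≠ 0 ∧ r ^ n = ‖c‖}

end DiffOp

end

end RigidLine

/-! The proof is Gröbner division in a Banach ring, as for Tate algebras, with noncommutativity
tamed by passing to a suitable power of `∂`. Write `A = 𝒪(X)` and `δ = ∂_x`. A presentation of `A`
by a Tate algebra and the open mapping theorem expand every `a ∈ A` in bounded monomials `X^α`, with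
coefficients at most a constant times `‖a‖` (`IsAffinoid.exists_expansion`). With scalars `d_k` of
size about `r^k`, the elements `X^α d_k⁻¹ ∂^k` expand every element of `𝒟_r(X)`, in general not
uniquely (`SkewTate.exists_expansion`).

Division needs multipliers that carry monomials to monomials up to a small error. The operator `∂`
need not be one, since `∂a - a∂ = δ(a)` need not be small against `r‖a‖`. However, `∂^N a` is the
sum of the terms `binom(N,m) δ^m(a) ∂^(N-m)`. If `N` is divisible by a high power of `p` and `m ≠
0`, then either the binomial coefficient is `p`-adically small, or a large power of `p` divides `m`.
In the latter case `m` is large, and `‖δ^m(a)‖ ≤ B s^m ‖a‖` with `s < r` is negligible against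
`r^m`. So a suitable `∂^q` almost commutes with `A` (`SkewTate.exists_small_commutator`). Since `r`
lies in `√|Kˣ|`, one can also arrange `r^q = |c|` with `c ∈ Kˣ`. Then `X^β c⁻ᵗ ∂^(qt)` shifts the
exponent `(k, α)` to `(k + qt, α + β)` with small error, and Dickson's lemma still holds for these
shifts because there are only `q` residue classes of `k`.

`MonomialFrame` records these properties, and `MonomialFrame.isNoetherianRing` draws the conclusion.
The leading exponent of an expansion is the highest one among those whose coefficients have maximal
norm. For a left ideal `J`, choose finitely many `u_i ∈ J` whose leading exponents yield all leading
exponents of `J` under the shifts. Dividing an element of `J` by the `u_i` leaves a remainder in `J`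
whose coefficients are at most `ε < 1` at every leading exponent of `J`. Its largest coefficient
sits at such an exponent, so all of them are at most `ε`. Iterating, the quotients sum geometrically
and the `u_i` generate `J`.

For the right-hand statement, `∑ a_k ∂^k ↦ ∑ ∂^k a_k` identifies the opposite ring with the
skew-Tate algebra of `-δ`, which has the same spectral radius (`SkewTate.reverseRingHom`). -/

namespace RigidLine

/-! ### A division criterion for left Noetherianity of Banach algebras -/

/-- A bounded, topologically generating family of monomials in a Banach algebra `R`, on which
elements `act g` act up to a small error by order-preserving shifts of the index set. -/
structure MonomialFrame (K R I G W : Type*) [NontriviallyNormedField K] [NormedRing R]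
    [NormedAlgebra K R] [LinearOrder W] where
  mono : I → R
  act : G → R
  shift : G → I → I
  rank : I → W
  monoBound : ℝ
  actBound : ℝ
  liftBound : ℝ
  error : ℝ
  rank_injective : Function.Injective rank
  rank_shift : ∀ g μ ν, rank μ < rank ν → rank (shift g μ) < rank (shift g ν)
  norm_mono_le : ∀ μ, ‖mono μ‖ ≤ monoBound
  norm_act_le : ∀ g, ‖act g‖ ≤ actBound
  liftBound_nonneg : 0 ≤ liftBound
  error_nonneg : 0 ≤ error
  -- Re-expanding an error of `act` costs a factor `liftBound`; the resulting coefficients must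
  -- still be uniformly below 1.
  liftBound_mul_error_lt : liftBound * error < 1
  exists_lift : ∀ u : R, ∃ f : I → K, Tendsto f cofinite (𝓝 0) ∧
    HasSum (fun μ => f μ • mono μ) u ∧ ∀ μ, ‖f μ‖ ≤ liftBound * ‖u‖
  norm_act_mul_sub_le : ∀ g μ, ‖act g * mono μ - mono (shift g μ)‖ ≤ error
  exists_finite_basis : ∀ T : Set I, ∃ F : Finset I, ↑F ⊆ T ∧
    ∀ ν ∈ T, ∃ μ ∈ F, ∃ g, shift g μ = ν

namespace MonomialFrame

variable {K R I G W : Type*} [NontriviallyNormedField K] [NormedRing R]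
  [NormedAlgebra K R] [LinearOrder W] (M : MonomialFrame K R I G W)

/-- `v = ∑ f μ • mono μ` with coefficients tending to zero. -/
def Expands (f : I → K) (v : R) : Prop :=
  Tendsto f cofinite (𝓝 0) ∧ HasSum (fun μ => f μ • M.mono μ) v

/-- `v` is a combination of the `u i` with coefficients bounded by `B`, up to a remainder with
coefficients bounded by `1`, and by `ε` on `U`. -/
def Divides (F : Finset I) (u : I → R) (U : Set I) (ε B : ℝ) (v : R) : Prop :=
  ∃ (a : I → R) (f : I → K) (w : R), (∀ i, ‖a i‖ ≤ B) ∧ M.Expands f w ∧ (∀ κ, ‖f κ‖ ≤ 1) ∧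
    (∀ κ ∈ U, ‖f κ‖ ≤ ε) ∧ v = ∑ i ∈ F, a i * u i + w

theorem injective_shift (g : G) : Function.Injective (M.shift g) := by
  intro μ ν h
  by_contra hne
  rcases lt_or_gt_of_ne (M.rank_injective.ne hne) with h1 | h1 <;>
  · have := M.rank_shift g _ _ h1
    rw [h] at this
    exact lt_irrefl _ this

/-! ### Expansions and division with remainder -/

variable {M}

theorem Expands.add {f g : I → K} {v w : R} (hf : M.Expands f v) (hg : M.Expands g w) :
    M.Expands (f + g) (v + w) :=
  ⟨by simpa [Pi.add_def] using hf.1.add hg.1, by simpa [add_smul] using hf.2.add hg.2⟩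

theorem Expands.smul {f : I → K} {v : R} (hf : M.Expands f v) (c : K) :
    M.Expands (c • f) (c • v) :=
  ⟨by simpa [Pi.smul_def] using hf.1.const_mul c, by simpa [mul_smul] using hf.2.const_smul c⟩

variable (M) in
theorem expands_zero : M.Expands 0 0 := ⟨tendsto_const_nhds, by simp⟩

variable (M) in
theorem expands_single [DecidableEq I] (μ : I) : M.Expands (Pi.single μ 1) (M.mono μ) := by
  refine ⟨?_, ?_⟩
  · refine tendsto_const_nhds.congr' ?_
    filter_upwards [(Set.finite_singleton μ).compl_mem_cofinite] with κ hκ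
    rw [Pi.single_eq_of_ne]
    simpa using hκ
  · convert hasSum_single (f := fun κ => (Pi.single μ 1 : I → K) κ • M.mono κ) μ ?_ using 1
    · simp
    · intro κ hκ
      simp [hκ]

variable [IsUltrametricDist K] [IsUltrametricDist R]
variable {F : Finset I} {u : I → R} {U : Set I} {ε B : ℝ}

/-- The ultrametric inequality preserves all the bounds without loss, so divisibility with fixed `B`
and `ε` passes to sums of any finite length. -/
theorem Divides.add {v w : R} (hv : M.Divides F u U ε B v) (hw : M.Divides F u U ε B w) :
    M.Divides F u U ε B (v + w) := by
  obtain ⟨a, f, v', ha, hf, hf1, hfU, rfl⟩ := hv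
  obtain ⟨b, g, w', hb, hg, hg1, hgU, rfl⟩ := hw
  refine ⟨a + b, f + g, v' + w', fun i => ?_, hf.add hg, fun κ => ?_, fun κ hκ => ?_, ?_⟩
  · exact (IsUltrametricDist.norm_add_le_max _ _).trans (max_le (ha i) (hb i))
  · exact (IsUltrametricDist.norm_add_le_max _ _).trans (max_le (hf1 κ) (hg1 κ))
  · exact (IsUltrametricDist.norm_add_le_max _ _).trans (max_le (hfU κ hκ) (hgU κ hκ))
  · simp only [Pi.add_apply, add_mul, Finset.sum_add_distrib]
    abel

theorem Divides.smul {v : R} (hv : M.Divides F u U ε B v) {c : K} (hc : ‖c‖ ≤ 1) :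
    M.Divides F u U ε B (c • v) := by
  obtain ⟨a, f, v', ha, hf, hf1, hfU, rfl⟩ := hv
  refine ⟨c • a, c • f, c • v', fun i => ?_, hf.smul c, fun κ => ?_, fun κ hκ => ?_, ?_⟩
  · refine (norm_smul_le _ _).trans ((mul_le_mul_of_nonneg_right hc (norm_nonneg _)).trans ?_)
    simpa using ha i
  · refine (norm_smul_le _ _).trans ((mul_le_mul_of_nonneg_right hc (norm_nonneg _)).trans ?_)
    simpa using hf1 κ
  · refine (norm_smul_le _ _).trans ((mul_le_mul_of_nonneg_right hc (norm_nonneg _)).trans ?_)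
    simpa using hfU κ hκ
  · simp [smul_add, Finset.smul_sum]

theorem divides_of_small (hB : 0 ≤ B) (hε1 : ε ≤ 1) {f : I → K} {v : R} (hf : M.Expands f v)
    (hfε : ∀ κ, ‖f κ‖ ≤ ε) : M.Divides F u U ε B v :=
  ⟨0, f, v, fun i => by simpa using hB, hf, fun κ => (hfε κ).trans hε1, fun κ _ => hfε κ,
    by simp⟩

theorem divides_sum (hB : 0 ≤ B) (hε0 : 0 ≤ ε) (hε1 : ε ≤ 1) {ι : Type*} (s : Finset ι)
    (v : ι → R) (h : ∀ i ∈ s, M.Divides F u U ε B (v i)) :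
    M.Divides F u U ε B (∑ i ∈ s, v i) := by
  classical
  induction s using Finset.induction_on with
  | empty =>
    rw [Finset.sum_empty]
    exact divides_of_small hB hε1 (M.expands_zero) (by simpa using fun _ => hε0)
  | insert i s hi ih =>
    rw [Finset.sum_insert hi]
    exact (h i (by simp)).add (ih fun j hj => h j (by simp [hj]))

theorem finite_lt_norm {f : I → K} (hf : Tendsto f cofinite (𝓝 0)) {c : ℝ} (hc : 0 < c) :
    {κ | c < ‖f κ‖}.Finite := by
  have h := (tendsto_zero_iff_norm_tendsto_zero.1 hf).eventually (gt_mem_nhds hc)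
  rw [eventually_cofinite] at h
  refine h.subset fun κ hκ => ?_
  simp only [Set.mem_ofPred_eq] at hκ ⊢
  exact not_lt.2 hκ.le

variable [CompleteSpace R]

theorem summable_of_tendsto {f : I → K} (hf : Tendsto f cofinite (𝓝 0)) {m : I → R} {b : ℝ}
    (hm : ∀ μ, ‖m μ‖ ≤ b) : Summable fun μ => f μ • m μ := by
  refine NonarchimedeanAddGroup.summable_of_tendsto_cofinite_zero ?_
  have h1 := (tendsto_zero_iff_norm_tendsto_zero.1 hf).mul_const b
  rw [zero_mul] at h1
  refine squeeze_zero_norm (fun μ => ?_) h1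
  exact (norm_smul_le _ _).trans (by gcongr; exact hm μ)

/-- Splitting a convergent expansion into finitely many large terms and a small remainder. -/
theorem Expands.split [DecidableEq I] {f : I → K} {v : R} (hf : M.Expands f v) (Q : Finset I) :
    M.Expands (fun κ => if κ ∈ Q then 0 else f κ) (v - ∑ κ ∈ Q, f κ • M.mono κ) := by
  refine ⟨?_, ?_⟩
  · refine squeeze_zero_norm (fun κ => ?_) (tendsto_zero_iff_norm_tendsto_zero.1 hf.1)
    split_ifs <;> simp
  · have h1 := hf.2.sub (hasSum_sum_of_ne_finset_zero
      (f := fun κ => if κ ∈ Q then f κ • M.mono κ else 0) (s := Q) (by simp +contextual))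
    rw [Finset.sum_congr rfl fun κ hκ => if_pos hκ] at h1
    refine h1.congr_fun fun κ => ?_
    by_cases h : κ ∈ Q <;> simp [h]

/-- All but finitely many terms have coefficients at most `ε` and go into the remainder; the
finitely many others are divided monomial by monomial. -/
theorem Expands.divides (hB : 0 ≤ B) (hε0 : 0 < ε) (hε1 : ε ≤ 1)
    (hmono : ∀ μ, M.Divides F u U ε B (M.mono μ)) {f : I → K} {v : R} (hf : M.Expands f v)
    (hf1 : ∀ κ, ‖f κ‖ ≤ 1) : M.Divides F u U ε B v := by
  classical
  let Q := (finite_lt_norm hf.1 hε0).toFinset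
  have h2 : M.Divides F u U ε B (v - ∑ κ ∈ Q, f κ • M.mono κ) := by
    refine divides_of_small hB hε1 (hf.split Q) fun κ => ?_
    split_ifs with h
    · simpa using hε0.le
    · simpa [Q] using h
  have h3 := h2.add (divides_sum hB hε0.le hε1 Q (fun κ => f κ • M.mono κ)
    fun κ _ => (hmono κ).smul (hf1 κ))
  rwa [sub_add_cancel] at h3

/-- Division of monomials. -/
theorem divides_mono [WellFoundedLT W] (hB : 0 ≤ B) (hBact : M.actBound ≤ B) (hε0 : 0 < ε)
    (hε1 : ε < 1) (hε : M.liftBound * M.error ≤ ε) (γ : I → I → K)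
    (hγ : ∀ μ ∈ F, M.Expands (γ μ) (u μ)) (hγ1 : ∀ μ ∈ F, ∀ κ, ‖γ μ κ‖ ≤ 1)
    (hγμ : ∀ μ ∈ F, γ μ μ = 1) (hγlt : ∀ μ ∈ F, ∀ κ, M.rank μ < M.rank κ → ‖γ μ κ‖ ≤ ε)
    (ν : I) : M.Divides F u {ν | ∃ μ ∈ F, ∃ g, M.shift g μ = ν} ε B (M.mono ν) := by
  classical
  set U : Set I := {ν | ∃ μ ∈ F, ∃ g, M.shift g μ = ν} with hU
  -- A monomial in `U` is replaced by a multiple of some `u μ`, monomials of lower rank, and terms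
  -- small enough for the remainder; the lower ones are handled by induction on the rank.
  induction ν using (InvImage.wf M.rank (wellFounded_lt (α := W))).induction with
  | _ ν ih =>
  have ih : ∀ κ, M.rank κ < M.rank ν → M.Divides F u U ε B (M.mono κ) := ih
  by_cases hν : ν ∈ U
  swap
  -- Outside `U` the monomial is its own remainder.
  · refine ⟨0, Pi.single ν 1, M.mono ν, fun i => by simpa using hB, M.expands_single ν,
      fun κ => ?_, fun κ hκ => ?_, by simp⟩
    · by_cases h : κ = ν
      · subst h; simp
      · simp [h]
    · have h : κ ≠ ν := fun h => hν (h ▸ hκ)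
      simpa [h] using hε0.le
  obtain ⟨μ, hμ, g, rfl⟩ := hν
  have hexp := hγ μ hμ
  -- The significant exponents of `u μ`: finitely many, including `μ`, and by `hγlt` all the others
  -- have lower rank than `μ`.
  let Q := (finite_lt_norm hexp.1 hε0).toFinset
  have hmemQ : ∀ κ, κ ∈ Q ↔ ε < ‖γ μ κ‖ := fun κ => by simp [Q]
  have hμQ : μ ∈ Q := by rw [hmemQ, hγμ μ hμ]; simpa using hε1
  -- The sum `s` is what `act g * u μ` would be if `act g` shifted monomials exactly.
  have hs := summable_of_tendsto hexp.1 (m := fun κ => M.mono (M.shift g κ))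
    (fun κ => M.norm_mono_le _)
  obtain ⟨s, hs⟩ := hs
  have hsexp : M.Expands (Function.extend (M.shift g) (γ μ) 0) s := by
    refine ⟨?_, ?_⟩
    · rw [Metric.tendsto_nhds]
      intro e he
      have h1 := (Metric.tendsto_nhds.1 hexp.1) e he
      rw [eventually_cofinite] at h1 ⊢
      refine (h1.image (M.shift g)).subset fun κ hκ => ?_
      by_cases h : ∃ κ', M.shift g κ' = κ
      · obtain ⟨κ', rfl⟩ := h
        refine ⟨κ', ?_, rfl⟩
        simpa [(M.injective_shift g).extend_apply] using hκ
      · exact absurd hκ (by simp [Function.extend_apply' _ _ _ h, he])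
    · rw [← hasSum_extend_zero (M.injective_shift g)] at hs
      convert hs using 1
      ext κ
      by_cases h : ∃ κ', M.shift g κ' = κ
      · obtain ⟨κ', rfl⟩ := h
        simp [(M.injective_shift g).extend_apply]
      · simp [Function.extend_apply' _ _ _ h]
  have hrest := hsexp.split (Q.image (M.shift g))
  rw [Finset.sum_image (fun a _ b _ h => M.injective_shift g h)] at hrest
  simp only [(M.injective_shift g).extend_apply] at hrest
  have hrest' : M.Divides F u U ε B (s - ∑ κ ∈ Q, γ μ κ • M.mono (M.shift g κ)) := by
    refine divides_of_small hB hε1.le hrest fun κ => ?_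
    split_ifs with h
    · simpa using hε0.le
    · by_cases h' : ∃ κ', M.shift g κ' = κ
      · obtain ⟨κ', rfl⟩ := h'
        rw [(M.injective_shift g).extend_apply]
        by_contra hc
        exact h (Finset.mem_image_of_mem _ ((hmemQ κ').2 (not_le.1 hc)))
      · rw [Function.extend_apply' _ _ _ h']
        simpa using hε0.le
  -- Each term of the difference is at most `error`, hence so is the sum, and lifting it gives
  -- coefficients at most `liftBound * error ≤ ε`.
  have herr : M.Divides F u U ε B (M.act g * u μ - s) := by
    obtain ⟨w, hw, hsum, hwle⟩ := M.exists_lift (M.act g * u μ - s)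
    refine divides_of_small hB hε1.le ⟨hw, hsum⟩ fun κ => (hwle κ).trans (le_trans ?_ hε)
    refine mul_le_mul_of_nonneg_left ?_ M.liftBound_nonneg
    have h1 := (hexp.2.mul_left (M.act g)).sub hs
    rw [← h1.tsum_eq]
    refine IsUltrametricDist.norm_tsum_le_of_forall_le_of_nonneg M.error_nonneg fun κ => ?_
    rw [mul_smul_comm, ← smul_sub]
    refine (norm_smul_le _ _).trans ?_
    calc _ ≤ 1 * M.error :=
          mul_le_mul (hγ1 μ hμ κ) (M.norm_act_mul_sub_le g κ) (norm_nonneg _) zero_le_one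
      _ = _ := one_mul _
  -- The shift preserves rank comparisons, so these monomials lie below `shift g μ`.
  have hlow : M.Divides F u U ε B (∑ κ ∈ Q.erase μ, γ μ κ • M.mono (M.shift g κ)) := by
    refine divides_sum hB hε0.le hε1.le _ _ fun κ hκ => ?_
    rw [Finset.mem_erase, hmemQ] at hκ
    refine (ih _ (M.rank_shift g _ _ ?_)).smul (hγ1 μ hμ κ)
    rcases lt_trichotomy (M.rank κ) (M.rank μ) with h | h | h
    · exact h
    · exact absurd (M.rank_injective h) hκ.1
    · exact absurd (hγlt μ hμ κ h) (not_le.2 hκ.2)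
  have hact : M.Divides F u U ε B (M.act g * u μ) :=
    ⟨Pi.single μ (M.act g), 0, 0, fun i => by
      by_cases h : i = μ
      · subst h; simpa using (M.norm_act_le g).trans hBact
      · simpa [h] using hB, M.expands_zero, by simp, fun _ _ => by simpa using hε0.le, by
      rw [Finset.sum_eq_single μ]
      · simp
      · intro b _ hb; simp [hb]
      · intro h; exact absurd hμ h⟩
  have hneg1 : ‖(-1 : K)‖ ≤ 1 := by simp
  -- With `γ μ μ = 1`, the monomial is `act g * u μ`, minus the commutation error, minus the small
  -- terms of `s`, minus the significant terms of lower rank.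
  have := ((hact.add (herr.smul hneg1)).add (hrest'.smul hneg1)).add (hlow.smul hneg1)
  convert this using 1
  rw [← Finset.add_sum_erase _ _ hμQ, hγμ μ hμ]
  simp only [neg_smul, one_smul]
  abel

/-! ### Leading exponents of a left ideal -/

theorem exists_scale {f : I → K} (hf : Tendsto f cofinite (𝓝 0)) (hne : ∃ κ, f κ ≠ 0) :
    ∃ κ, f κ ≠ 0 ∧ (∀ κ', ‖f κ'‖ ≤ ‖f κ‖) ∧
      ∀ κ', M.rank κ < M.rank κ' → ‖f κ'‖ < ‖f κ‖ := by
  obtain ⟨κ₀, h0⟩ := hne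
  have hfin := finite_lt_norm hf (half_pos (norm_pos_iff.2 h0))
  have hin : κ₀ ∈ hfin.toFinset := by simp [h0]
  obtain ⟨κ₁, h1, hmax⟩ := Finset.exists_max_image hfin.toFinset (fun κ => ‖f κ‖) ⟨_, hin⟩
  have hmax' : ∀ κ, ‖f κ‖ ≤ ‖f κ₁‖ := by
    intro κ
    by_cases h : κ ∈ hfin.toFinset
    · exact hmax κ h
    · have h2 : ‖f κ‖ ≤ ‖f κ₀‖ / 2 := by simpa using h
      have h3 := hmax κ₀ hin
      have := norm_nonneg (f κ₀)
      linarith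
  have hne1 : f κ₁ ≠ 0 := by
    rw [← norm_pos_iff]
    exact (norm_pos_iff.2 h0).trans_le (hmax' κ₀)
  have hfin2 : {κ | ‖f κ‖ = ‖f κ₁‖}.Finite :=
    (finite_lt_norm hf (half_pos (norm_pos_iff.2 hne1))).subset fun κ hκ => by
      have : ‖f κ‖ = ‖f κ₁‖ := hκ
      simp only [Set.mem_ofPred_eq]
      rw [this]
      exact half_lt_self (norm_pos_iff.2 hne1)
  -- The maximal norm is attained finitely often; taking the highest rank among those exponents
  -- makes the later coefficients strictly smaller.
  obtain ⟨κ₂, h2, hmax2⟩ := Finset.exists_max_image hfin2.toFinset M.rank ⟨κ₁, by simp⟩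
  have h2' : ‖f κ₂‖ = ‖f κ₁‖ := by simpa using h2
  refine ⟨κ₂, by rw [← norm_pos_iff, h2']; exact norm_pos_iff.2 hne1, fun κ => h2' ▸ hmax' κ,
    fun κ hκ => lt_of_le_of_ne (h2' ▸ hmax' κ) fun h => ?_⟩
  exact absurd (hmax2 κ (by simpa using h.trans h2')) (not_le.2 hκ)

variable (M) in
/-- The leading exponents of the expansions of the elements of `J`. -/
def leadingExponents (J : Ideal R) : Set I :=
  {μ | ∃ (f : I → K) (v : R), v ∈ J ∧ M.Expands f v ∧ (∀ κ, ‖f κ‖ ≤ 1) ∧ f μ = 1 ∧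
    ∀ κ, M.rank μ < M.rank κ → ‖f κ‖ < 1}

/-- Dividing by the leading coefficient normalises the expansion. This applies to every expansion of
every element of `J`, including nontrivial expansions of 0, so non-uniqueness does no harm. -/
theorem exists_leadingExponent {J : Ideal R} {f : I → K} {v : R} (hv : v ∈ J)
    (hf : M.Expands f v) (hne : ∃ κ, f κ ≠ 0) :
    ∃ κ ∈ M.leadingExponents J, f κ ≠ 0 ∧ ∀ κ', ‖f κ'‖ ≤ ‖f κ‖ := by
  obtain ⟨κ, h0, hmax, hlt⟩ := exists_scale (M := M) hf.1 hne
  refine ⟨κ, ⟨(f κ)⁻¹ • f, (f κ)⁻¹ • v, ?_, hf.smul _, fun κ' => ?_, ?_, fun κ' hκ' => ?_⟩, h0,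
    hmax⟩
  · rw [Algebra.smul_def]
    exact J.mul_mem_left _ hv
  · rw [Pi.smul_apply, smul_eq_mul, norm_mul, norm_inv, inv_mul_le_one₀ (norm_pos_iff.2 h0)]
    exact hmax κ'
  · simp [h0]
  · rw [Pi.smul_apply, smul_eq_mul, norm_mul, norm_inv, inv_mul_lt_one₀ (norm_pos_iff.2 h0)]
    exact hlt κ' hκ'

/-- Only finitely many coefficients exceed `1 / 2`, so the pointwise strict bound becomes uniform.
-/
theorem exists_gap {γ : I → K} (hγ : Tendsto γ cofinite (𝓝 0)) (μ : I)
    (hlt : ∀ κ, M.rank μ < M.rank κ → ‖γ κ‖ < 1) :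
    ∃ ε : ℝ, ε < 1 ∧ ∀ κ, M.rank μ < M.rank κ → ‖γ κ‖ ≤ ε := by
  have hfin := (finite_lt_norm hγ (half_pos one_pos)).inter_of_left {κ | M.rank μ < M.rank κ}
  rcases hfin.toFinset.eq_empty_or_nonempty with he | hn
  · refine ⟨1 / 2, by norm_num, fun κ hκ => ?_⟩
    by_contra hc
    have : κ ∈ hfin.toFinset := by
      rw [Set.Finite.mem_toFinset]
      exact ⟨not_le.1 hc, hκ⟩
    rw [he] at this
    simp at this
  · obtain ⟨κ₀, h0, hmax⟩ := Finset.exists_max_image hfin.toFinset (fun κ => ‖γ κ‖) hn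
    rw [Set.Finite.mem_toFinset] at h0
    refine ⟨‖γ κ₀‖, hlt κ₀ h0.2, fun κ hκ => ?_⟩
    by_cases hc : 1 / 2 < ‖γ κ‖
    · exact hmax κ ((Set.Finite.mem_toFinset _).2 ⟨hc, hκ⟩)
    · exact (not_lt.1 hc).trans h0.1.le

/-- One step of the division algorithm inside an ideal. -/
theorem exists_division_step {J : Ideal R} (hB : 0 ≤ B) (hε0 : 0 < ε) (hε1 : ε < 1)
    (hu : ∀ i ∈ F, u i ∈ J) (hmono : ∀ μ, M.Divides F u U ε B (M.mono μ))
    (hJU : M.leadingExponents J ⊆ U) {f : I → K} {v : R} (hv : v ∈ J) (hf : M.Expands f v)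
    {c : ℝ} (hfc : ∀ κ, ‖f κ‖ ≤ c) :
    ∃ (a : I → R) (f' : I → K) (v' : R), v' ∈ J ∧ M.Expands f' v' ∧ (∀ κ, ‖f' κ‖ ≤ ε * c) ∧
      (∀ i, ‖a i‖ ≤ B * c) ∧ v = ∑ i ∈ F, a i * u i + v' := by
  by_cases hne : ∃ κ, f κ ≠ 0
  swap
  · push Not at hne
    -- If there are no exponents, nothing forces `c` to be nonnegative.
    by_cases hI : IsEmpty I
    · refine ⟨0, 0, 0, J.zero_mem, M.expands_zero, fun κ => (hI.false κ).elim,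
        fun i => (hI.false i).elim, ?_⟩
      simpa using hf.2.unique hasSum_empty
    obtain ⟨κ⟩ := not_isEmpty_iff.1 hI
    have hc : 0 ≤ c := (norm_nonneg _).trans (hfc κ)
    exact ⟨0, f, v, hv, hf, fun κ => by rw [hne κ, norm_zero]; positivity,
      fun i => by simpa using by positivity, by simp⟩
  obtain ⟨κ, -, h0, hmax⟩ := exists_leadingExponent hv hf hne
  have hd := (hf.smul (f κ)⁻¹).divides hB hε0 hε1.le hmono fun κ' => by
    rw [Pi.smul_apply, smul_eq_mul, norm_mul, norm_inv, inv_mul_le_one₀ (norm_pos_iff.2 h0)]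
    exact hmax κ'
  obtain ⟨a, f', v', ha, hf', hf1, hfU, heq⟩ := hd
  have hv' : v' ∈ J := by
    have h1 : (f κ)⁻¹ • v ∈ J := by
      rw [Algebra.smul_def]
      exact J.mul_mem_left _ hv
    have h2 : ∑ i ∈ F, a i * u i ∈ J := J.sum_mem fun i hi => J.mul_mem_left _ (hu i hi)
    have h3 : v' = (f κ)⁻¹ • v - ∑ i ∈ F, a i * u i := by rw [heq]; abel
    rw [h3]
    exact J.sub_mem h1 h2
  -- The crux: the remainder is in `J`, so its largest coefficient occurs at a leading exponent of
  -- `J`, hence in `U`, where the bound is `ε`.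
  have hsmall : ∀ κ', ‖f' κ'‖ ≤ ε := by
    by_cases hne' : ∃ κ', f' κ' ≠ 0
    · obtain ⟨κ₁, hκ₁, -, hm⟩ := exists_leadingExponent hv' hf' hne'
      exact fun κ' => (hm κ').trans (hfU κ₁ (hJU hκ₁))
    · push Not at hne'
      intro κ'
      rw [hne' κ', norm_zero]
      exact hε0.le
  refine ⟨f κ • a, f κ • f', f κ • v', ?_, hf'.smul _, fun κ' => ?_, fun i => ?_, ?_⟩
  · rw [Algebra.smul_def]
    exact J.mul_mem_left _ hv'
  · rw [Pi.smul_apply, smul_eq_mul, norm_mul, mul_comm]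
    exact mul_le_mul (hsmall κ') (hfc κ) (norm_nonneg _) hε0.le
  · rw [Pi.smul_apply, mul_comm]
    exact (norm_smul_le _ _).trans (mul_le_mul (hfc κ) (ha i) (norm_nonneg _)
      ((norm_nonneg _).trans (hfc κ)))
  · have : v = f κ • ((f κ)⁻¹ • v) := by rw [smul_smul, mul_inv_cancel₀ h0, one_smul]
    rw [this, heq, smul_add, Finset.smul_sum]
    simp

/-- Each division step shrinks the coefficients by `ε`, so the successive quotients decay
geometrically and sum by completeness. The result lies in the span itself, not only in its closure.
-/
theorem mem_span_of_division {J : Ideal R} (hB : 0 ≤ B) (hε0 : 0 < ε) (hε1 : ε < 1)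
    (hu : ∀ i ∈ F, u i ∈ J) (hmono : ∀ μ, M.Divides F u U ε B (M.mono μ))
    (hJU : M.leadingExponents J ⊆ U) {v : R} (hv : v ∈ J) :
    ∃ a : I → R, v = ∑ i ∈ F, a i * u i := by
  obtain ⟨f, hf, hsum, hfc⟩ := M.exists_lift v
  set c := M.liftBound * ‖v‖
  -- The state keeps the expansion with the element, because a division step controls that
  -- particular expansion and the next step starts from it.
  let S (t : ℕ) := {x : (I → K) × R // x.2 ∈ J ∧ M.Expands x.1 x.2 ∧ ∀ κ, ‖x.1 κ‖ ≤ ε ^ t * c}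
  have hstep : ∀ (t : ℕ) (x : S t), ∃ (a : I → R) (y : S (t + 1)),
      (∀ i, ‖a i‖ ≤ B * (ε ^ t * c)) ∧ x.1.2 = ∑ i ∈ F, a i * u i + y.1.2 := by
    rintro t ⟨⟨f, v⟩, hv, hf, hfc⟩
    obtain ⟨a, f', v', h1, h2, h3, h4, h5⟩ :=
      exists_division_step hB hε0 hε1 hu hmono hJU hv hf hfc
    exact ⟨a, ⟨(f', v'), h1, h2, fun κ => by rw [pow_succ', mul_assoc]; exact h3 κ⟩, h4, h5⟩
  choose A Y hA hY using hstep
  let X : ∀ t, S t := fun t => Nat.rec (motive := S)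
    ⟨(f, v), hv, ⟨hf, hsum⟩, fun κ => by simpa using hfc κ⟩ (fun t x => Y t x) t
  have hX : ∀ t, (X t).1.2 = ∑ i ∈ F, A t (X t) i * u i + (X (t + 1)).1.2 := fun t => hY t (X t)
  have hpow := (tendsto_pow_atTop_nhds_zero_of_lt_one hε0.le hε1).mul_const c
  rw [zero_mul] at hpow
  have hsumm : ∀ i, Summable fun t => A t (X t) i := by
    intro i
    refine NonarchimedeanAddGroup.summable_of_tendsto_cofinite_zero ?_
    rw [Nat.cofinite_eq_atTop]
    have h1 := hpow.const_mul B
    rw [mul_zero] at h1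
    exact squeeze_zero_norm (fun t => hA t (X t) i) h1
  have hpart : ∀ N, v = ∑ i ∈ F, (∑ t ∈ Finset.range N, A t (X t) i) * u i + (X N).1.2 := by
    intro N
    induction N with
    | zero => simp [X]
    | succ N ih =>
      rw [ih, hX N]
      simp only [Finset.sum_range_succ, add_mul, Finset.sum_add_distrib]
      abel
  have hlim0 : Tendsto (fun N => (X N).1.2) atTop (𝓝 0) := by
    by_cases hI : IsEmpty I
    · have : ∀ N, (X N).1.2 = 0 := fun N =>
        (X N).2.2.1.2.unique hasSum_empty
      simp [this]
    obtain ⟨κ⟩ := not_isEmpty_iff.1 hI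
    have hb : 0 ≤ M.monoBound := (norm_nonneg _).trans (M.norm_mono_le κ)
    have h1 := hpow.mul_const M.monoBound
    rw [zero_mul] at h1
    refine squeeze_zero_norm (fun N : ℕ => ?_) h1
    have hc : 0 ≤ ε ^ N * c := (norm_nonneg _).trans ((X N).2.2.2 κ)
    rw [← (X N).2.2.1.2.tsum_eq]
    refine IsUltrametricDist.norm_tsum_le_of_forall_le_of_nonneg (by positivity) fun κ => ?_
    exact (norm_smul_le _ _).trans (mul_le_mul ((X N).2.2.2 κ) (M.norm_mono_le κ)
      (norm_nonneg _) hc)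
  refine ⟨fun i => ∑' t, A t (X t) i, ?_⟩
  have hlim : Tendsto (fun N => ∑ i ∈ F, (∑ t ∈ Finset.range N, A t (X t) i) * u i + (X N).1.2)
      atTop (𝓝 (∑ i ∈ F, (∑' t, A t (X t) i) * u i + 0)) :=
    (tendsto_finsetSum F fun i _ => (hsumm i).hasSum.tendsto_sum_nat.mul_const (u i)).add hlim0
  rw [add_zero] at hlim
  refine tendsto_nhds_unique ?_ hlim
  exact tendsto_const_nhds.congr hpart

/-- The elements whose leading exponents form a finite basis under the shifts generate the ideal by
the division algorithm. -/
theorem isNoetherianRing [WellFoundedLT W] (M : MonomialFrame K R I G W) :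
    IsNoetherianRing R := by
  classical
  rw [isNoetherianRing_iff_ideal_fg]
  intro J
  obtain ⟨F, hFT, hF⟩ := M.exists_finite_basis (M.leadingExponents J)
  have hdata : ∀ μ : I, ∃ (f : I → K) (v : R), μ ∈ F → (v ∈ J ∧ M.Expands f v ∧
      (∀ κ, ‖f κ‖ ≤ 1) ∧ f μ = 1 ∧ ∀ κ, M.rank μ < M.rank κ → ‖f κ‖ < 1) := by
    intro μ
    by_cases hμ : μ ∈ F
    · obtain ⟨f, v, h⟩ := hFT hμ
      exact ⟨f, v, fun _ => h⟩
    · exact ⟨0, 0, fun h => absurd h hμ⟩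
  choose γ u hγu using hdata
  have hgap : ∀ μ : I, ∃ e : ℝ, e < 1 ∧ (μ ∈ F → ∀ κ, M.rank μ < M.rank κ → ‖γ μ κ‖ ≤ e) := by
    intro μ
    by_cases hμ : μ ∈ F
    · obtain ⟨e, he, h⟩ := exists_gap (M := M) (hγu μ hμ).2.1.1 μ (hγu μ hμ).2.2.2.2
      exact ⟨e, he, fun _ => h⟩
    · exact ⟨0, one_pos, fun h => absurd h hμ⟩
  choose e he1 he using hgap
  -- One `ε < 1` serves all purposes: `1 / 2` keeps it positive, `liftBound * error` absorbs the
  -- commutation error, and the gaps `e μ` cover the terms above each leading exponent.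
  obtain ⟨ε, hε1, hε⟩ : ∃ ε : ℝ, ε < 1 ∧ ∀ x ∈ insert (1 / 2) (insert (M.liftBound * M.error)
      (F.image e)), x ≤ ε := by
    obtain ⟨x, hx, hmax⟩ := Finset.exists_max_image (insert (1 / 2 : ℝ)
      (insert (M.liftBound * M.error) (F.image e))) id ⟨1 / 2, by simp⟩
    refine ⟨x, ?_, hmax⟩
    simp only [Finset.mem_insert, Finset.mem_image] at hx
    rcases hx with rfl | rfl | ⟨μ, _, rfl⟩
    · norm_num
    · exact M.liftBound_mul_error_lt
    · exact he1 μ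
  have hε0 : 0 < ε := lt_of_lt_of_le (by norm_num) (hε (1 / 2) (by simp))
  -- The maximum is needed because `actBound` may be negative when `G` is empty.
  have hB : 0 ≤ max M.actBound 0 := le_max_right _ _
  have hmono := divides_mono (M := M) (F := F) (u := u) hB (le_max_left _ _) hε0 hε1
    (hε _ (by simp)) γ (fun μ hμ => (hγu μ hμ).2.1) (fun μ hμ => (hγu μ hμ).2.2.1)
    (fun μ hμ => (hγu μ hμ).2.2.2.1) (fun μ hμ κ hκ => (he μ hμ κ hκ).trans
      (hε _ (by simp only [Finset.mem_insert, Finset.mem_image]; exact Or.inr (Or.inr ⟨μ, hμ, rfl⟩))))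
  refine ⟨F.image u, le_antisymm (Submodule.span_le.2 ?_) fun v hv => ?_⟩
  · intro w hw
    simp only [Finset.coe_image, Set.mem_image, Finset.mem_coe] at hw
    obtain ⟨μ, hμ, rfl⟩ := hw
    exact (hγu μ hμ).1
  · obtain ⟨a, rfl⟩ := mem_span_of_division hB hε0 hε1 (fun i hi => (hγu i hi).1) hmono
      (fun ν hν => hF ν hν) hv
    refine Submodule.sum_mem _ fun i hi => Submodule.smul_mem _ (a i) (Submodule.subset_span ?_)
    exact Finset.mem_coe.2 (Finset.mem_image_of_mem u hi)

end MonomialFrame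

end RigidLine

namespace RigidLine

noncomputable section

/-! ### The skew-Tate algebra as a Banach algebra -/

namespace SkewTate

variable {K : Type u} [NontriviallyNormedField K]
variable {A : Type u} [NormedCommRing A] [NormedAlgebra K A]
variable {δ : Derivation K A A} {r : ℝ} {h : IsAdmissible δ r}

/-- The norm `sup ‖δᵐ(uⱼ)‖ rʲ⁻ᵐ`. It is submultiplicative and equivalent to `sup ‖uⱼ‖ rʲ`. -/
instance : Norm (SkewTate δ r h) :=
  ⟨fun u => ⨆ p : ℕ × ℕ, ‖δ^[p.1] (u.coeff p.2)‖ * r ^ p.2 / r ^ p.1⟩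

theorem norm_def (u : SkewTate δ r h) :
    ‖u‖ = ⨆ p : ℕ × ℕ, ‖δ^[p.1] (u.coeff p.2)‖ * r ^ p.2 / r ^ p.1 := rfl

theorem norm_nonneg' (u : SkewTate δ r h) : 0 ≤ ‖u‖ := by
  have hr := h.pos
  exact Real.iSup_nonneg fun p => by positivity

theorem norm_le_of {u : SkewTate δ r h} {M : ℝ}
    (H : ∀ m j, ‖δ^[m] (u.coeff j)‖ * r ^ j ≤ M * r ^ m) : ‖u‖ ≤ M := by
  have hr := h.pos
  exact ciSup_le fun p => (div_le_iff₀ (by positivity)).2 (H p.1 p.2)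

theorem bddAbove_norm (u : SkewTate δ r h) :
    BddAbove (Set.range fun p : ℕ × ℕ => ‖δ^[p.1] (u.coeff p.2)‖ * r ^ p.2 / r ^ p.1) := by
  have hr := h.pos
  obtain ⟨C, hC0, hC⟩ := h.exists_bound
  obtain ⟨V, hV0, hV⟩ := u.exists_coeff_bound
  refine ⟨C * V, ?_⟩
  rintro _ ⟨⟨m, j⟩, rfl⟩
  rw [div_le_iff₀ (by positivity)]
  calc ‖δ^[m] (u.coeff j)‖ * r ^ j ≤ C * r ^ m * ‖u.coeff j‖ * r ^ j := by gcongr; exact hC _ _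
    _ = C * (‖u.coeff j‖ * r ^ j) * r ^ m := by ring
    _ ≤ C * V * r ^ m := by gcongr; exact hV j

theorem norm_iterate_le (u : SkewTate δ r h) (m j : ℕ) :
    ‖δ^[m] (u.coeff j)‖ * r ^ j ≤ ‖u‖ * r ^ m := by
  have hr := h.pos
  rw [← div_le_iff₀ (by positivity)]
  exact le_ciSup u.bddAbove_norm (m, j)

theorem norm_coeff_le (u : SkewTate δ r h) (j : ℕ) : ‖u.coeff j‖ * r ^ j ≤ ‖u‖ := by
  simpa using u.norm_iterate_le 0 j

/-- The norm is bounded by a multiple of `sup ‖uⱼ‖ rʲ`. -/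
theorem exists_norm_le (h : IsAdmissible δ r) :
    ∃ C : ℝ, 0 ≤ C ∧ ∀ (u : SkewTate δ r h) (V : ℝ), (∀ j, ‖u.coeff j‖ * r ^ j ≤ V) →
      ‖u‖ ≤ C * V := by
  have hr := h.pos
  obtain ⟨C, hC0, hC⟩ := h.exists_bound
  refine ⟨C, hC0, fun u V hV => norm_le_of fun m j => ?_⟩
  calc ‖δ^[m] (u.coeff j)‖ * r ^ j ≤ C * r ^ m * ‖u.coeff j‖ * r ^ j := by gcongr; exact hC _ _
    _ = C * (‖u.coeff j‖ * r ^ j) * r ^ m := by ring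
    _ ≤ C * V * r ^ m := by gcongr; exact hV j

@[simp] theorem coeff_neg (u : SkewTate δ r h) (j : ℕ) : (-u).coeff j = -u.coeff j := rfl

@[simp] theorem coeff_sub (u v : SkewTate δ r h) (j : ℕ) :
    (u - v).coeff j = u.coeff j - v.coeff j := by
  rw [sub_eq_add_neg, coeff_add, coeff_neg, sub_eq_add_neg]

variable [IsUltrametricDist A]

theorem norm_add_le_max' (u v : SkewTate δ r h) : ‖u + v‖ ≤ max ‖u‖ ‖v‖ := by
  have hr := h.pos
  refine norm_le_of fun m j => ?_
  rw [coeff_add, iterate_map_add]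
  refine (mul_le_mul_of_nonneg_right (IsUltrametricDist.norm_add_le_max _ _)
    (by positivity)).trans ?_
  rw [max_mul_of_nonneg _ _ (by positivity), max_mul_of_nonneg _ _ (by positivity)]
  exact max_le_max (u.norm_iterate_le m j) (v.norm_iterate_le m j)

/-- The norm as an additive group norm. -/
def groupNorm : AddGroupNorm (SkewTate δ r h) where
  toFun u := ‖u‖
  map_zero' := le_antisymm (norm_le_of fun m j => by simp [iterate_map_zero]) (norm_nonneg' _)
  add_le' u v := (norm_add_le_max' u v).trans
    (max_le_add_of_nonneg (norm_nonneg' u) (norm_nonneg' v))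
  neg' u := by simp [norm_def, iterate_map_neg]
  eq_zero_of_map_eq_zero' u hu := by
    have hr := h.pos
    ext j
    have h1 := u.norm_coeff_le j
    have hu' : ‖u‖ = 0 := hu
    rw [hu'] at h1
    have h2 : ‖u.coeff j‖ ≤ 0 := by
      by_contra hc
      exact absurd h1 (not_le.2 (mul_pos (not_le.1 hc) (pow_pos hr j)))
    simpa using h2

instance : NormedAddCommGroup (SkewTate δ r h) :=
  { groupNorm.toNormedAddCommGroup with
    toNorm := inferInstance
    toAddCommGroup := inferInstance }

instance : IsUltrametricDist (SkewTate δ r h) :=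
  IsUltrametricDist.isUltrametricDist_of_isNonarchimedean_norm norm_add_le_max'

/-- Replacing `a` by `δ a` only multiplies its constant `α` by `r`, so induction with the Leibniz
rule works for all pairs at once; the ultrametric inequality avoids any binomial factor. -/
theorem norm_iterate_mul_le {α β : ℝ} (m : ℕ) : ∀ {a b : A},
    (∀ m, ‖δ^[m] a‖ ≤ α * r ^ m) → (∀ m, ‖δ^[m] b‖ ≤ β * r ^ m) →
      ‖δ^[m] (a * b)‖ ≤ α * β * r ^ m := by
  induction m generalizing α β with
  | zero =>
    intro a b ha hb
    have h1 : ‖a‖ ≤ α := by simpa using ha 0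
    have h2 : ‖b‖ ≤ β := by simpa using hb 0
    simpa using (norm_mul_le a b).trans (mul_le_mul h1 h2 (norm_nonneg _)
      ((norm_nonneg _).trans h1))
  | succ m ih =>
    intro a b ha hb
    rw [Function.iterate_succ_apply, Derivation.leibniz, smul_eq_mul, smul_eq_mul,
      iterate_map_add]
    have ha' : ∀ m, ‖δ^[m] (δ a)‖ ≤ α * r * r ^ m := fun m => by
      rw [← Function.iterate_succ_apply, mul_assoc, ← pow_succ']
      exact ha (m + 1)
    have hb' : ∀ m, ‖δ^[m] (δ b)‖ ≤ β * r * r ^ m := fun m => by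
      rw [← Function.iterate_succ_apply, mul_assoc, ← pow_succ']
      exact hb (m + 1)
    refine (IsUltrametricDist.norm_add_le_max _ _).trans (max_le ?_ ?_)
    · exact (ih ha hb').trans_eq (by ring)
    · exact (ih hb ha').trans_eq (by ring)

variable [CompleteSpace A]

/-- The supremum over `m` in the norm is there for this: applying `δ` to coefficients merely shifts
`m`, at the cost of exactly `r`, just like raising the degree. -/
theorem norm_D_le (u : SkewTate δ r h) : ‖D u‖ ≤ r * ‖u‖ := by
  have hr := h.pos
  refine norm_le_of fun m j => ?_
  have h1 : ∀ j, ‖δ^[m] (δ (u.coeff j))‖ * r ^ j ≤ r * ‖u‖ * r ^ m := fun j => by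
    rw [← Function.iterate_succ_apply]
    exact (u.norm_iterate_le (m + 1) j).trans_eq (by ring)
  cases j with
  | zero => exact h1 0
  | succ j =>
    rw [coeff_D_succ, iterate_map_add]
    refine (mul_le_mul_of_nonneg_right (IsUltrametricDist.norm_add_le_max _ _)
      (by positivity)).trans ?_
    rw [max_mul_of_nonneg _ _ (by positivity)]
    refine max_le ?_ (h1 (j + 1))
    calc ‖δ^[m] (u.coeff j)‖ * r ^ (j + 1) = r * (‖δ^[m] (u.coeff j)‖ * r ^ j) := by ring
      _ ≤ r * (‖u‖ * r ^ m) := mul_le_mul_of_nonneg_left (u.norm_iterate_le m j) hr.le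
      _ = _ := by ring

theorem norm_D_iterate_le (i : ℕ) (u : SkewTate δ r h) : ‖D^[i] u‖ ≤ r ^ i * ‖u‖ := by
  have hr := h.pos
  induction i with
  | zero => simp
  | succ i ih =>
    rw [Function.iterate_succ_apply', pow_succ', mul_assoc]
    exact (norm_D_le _).trans (by gcongr)

theorem norm_mul_le' (u v : SkewTate δ r h) : ‖u * v‖ ≤ ‖u‖ * ‖v‖ := by
  have hr := h.pos
  refine norm_le_of fun m k => ?_
  rw [coeff_mul, ← le_div_iff₀ (by positivity)]
  have hcont : Continuous (δ^[m]) := h.1.iterate m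
  have h1 := (summable_term u v k).hasSum.map
    (AddMonoidHom.mk' (δ^[m]) fun a b => iterate_map_add δ m a b) hcont
  have h2 := h1.tsum_eq
  rw [AddMonoidHom.mk'_apply] at h2
  rw [← h2]
  refine IsUltrametricDist.norm_tsum_le_of_forall_le_of_nonneg (by positivity) fun i => ?_
  change ‖δ^[m] (u.coeff i * (D^[i] v).coeff k)‖ ≤ _
  have h3 : ∀ m, ‖δ^[m] (u.coeff i)‖ ≤ ‖u‖ / r ^ i * r ^ m := fun m => by
    rw [div_mul_eq_mul_div, le_div_iff₀ (by positivity)]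
    exact u.norm_iterate_le m i
  have h4 : ∀ m, ‖δ^[m] ((D^[i] v).coeff k)‖ ≤ r ^ i * ‖v‖ / r ^ k * r ^ m := fun m => by
    rw [div_mul_eq_mul_div, le_div_iff₀ (by positivity)]
    refine ((D^[i] v).norm_iterate_le m k).trans ?_
    gcongr
    exact norm_D_iterate_le i v
  refine (norm_iterate_mul_le m h3 h4).trans_eq ?_
  field_simp

instance : NormedRing (SkewTate δ r h) :=
  { (inferInstance : NormedAddCommGroup (SkewTate δ r h)),
    (inferInstance : Ring (SkewTate δ r h)) with
    norm_mul_le := norm_mul_le' }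

/-- Coefficients depend continuously on the series. -/
def coeffHom (j : ℕ) : SkewTate δ r h →+ A := ⟨⟨fun u => u.coeff j, rfl⟩, fun _ _ => rfl⟩

theorem continuous_coeff (j : ℕ) : Continuous fun u : SkewTate δ r h => u.coeff j := by
  have hr := h.pos
  refine AddMonoidHomClass.continuous_of_bound (coeffHom j) (r ^ j)⁻¹ fun u => ?_
  rw [inv_mul_eq_div, le_div_iff₀ (by positivity)]
  exact u.norm_coeff_le j

instance : CompleteSpace (SkewTate δ r h) := by
  have hr := h.pos
  refine Metric.complete_of_cauchySeq_tendsto fun u hu => ?_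
  have hco : ∀ j, CauchySeq fun n => (u n).coeff j := fun j => by
    have huc : UniformContinuous (coeffHom j : SkewTate δ r h →+ A) :=
      uniformContinuous_addMonoidHom_of_continuous (continuous_coeff j)
    exact huc.comp_cauchySeq hu
  choose a ha using fun j => cauchySeq_tendsto_of_complete (hco j)
  have hclose : ∀ ε > 0, ∃ N, ∀ n ≥ N, ∀ j, ‖(u n).coeff j - a j‖ * r ^ j ≤ ε := by
    intro ε hε
    obtain ⟨N, hN⟩ := Metric.cauchySeq_iff.1 hu ε hε
    refine ⟨N, fun n hn j => ?_⟩
    have h1 : Tendsto (fun k => ‖(u n).coeff j - (u k).coeff j‖ * r ^ j) atTop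
        (𝓝 (‖(u n).coeff j - a j‖ * r ^ j)) :=
      ((tendsto_const_nhds.sub (ha j)).norm).mul_const _
    refine le_of_tendsto h1 ?_
    filter_upwards [eventually_ge_atTop N] with k hk
    have h2 := (u n - u k).norm_coeff_le j
    rw [coeff_sub] at h2
    have h3 := hN n hn k hk
    rw [dist_eq_norm] at h3
    exact h2.trans h3.le
  have hlim : Tendsto (fun j => ‖a j‖ * r ^ j) atTop (𝓝 0) := by
    rw [Metric.tendsto_nhds]
    intro ε hε
    obtain ⟨N, hN⟩ := hclose (ε / 3) (by positivity)
    filter_upwards [(u N).tendsto_coeff.eventually (gt_mem_nhds (show 0 < ε / 3 by positivity))]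
      with j hj
    rw [Real.dist_0_eq_abs, abs_of_nonneg (by positivity)]
    have h1 := hN N le_rfl j
    have h2 : ‖a j‖ ≤ ‖(u N).coeff j‖ + ‖(u N).coeff j - a j‖ := by
      have := norm_sub_le ((u N).coeff j) ((u N).coeff j - a j)
      rwa [sub_sub_cancel] at this
    have h3 := mul_le_mul_of_nonneg_right h2 (pow_pos hr j).le
    rw [add_mul] at h3
    linarith
  let b : SkewTate δ r h := ⟨a, hlim⟩
  refine ⟨b, ?_⟩
  -- Coefficientwise limits are controlled only in the weighted supremum norm; equivalence of norms
  -- transfers the convergence.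
  obtain ⟨C, hC0, hC⟩ := exists_norm_le h
  rw [tendsto_iff_norm_sub_tendsto_zero, Metric.tendsto_atTop]
  intro ε hε
  obtain ⟨N, hN⟩ := hclose (ε / (C + 1)) (by positivity)
  refine ⟨N, fun n hn => ?_⟩
  rw [Real.dist_0_eq_abs, abs_of_nonneg (norm_nonneg _)]
  refine (hC _ (ε / (C + 1)) fun j => ?_).trans_lt ?_
  · rw [coeff_sub]
    exact hN n hn j
  · rw [mul_div_assoc', div_lt_iff₀ (by positivity)]
    nlinarith

/-! #### Constants, the generator `∂`, monomials -/

/-- The monomial `a ∂ᵏ`. -/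
def monomial (k : ℕ) (a : A) : SkewTate δ r h :=
  ⟨fun j => if j = k then a else 0, tendsto_const_nhds.congr' (by
    filter_upwards [eventually_gt_atTop k] with j hj
    simp [hj.ne'])⟩

theorem coeff_monomial (k : ℕ) (a : A) (j : ℕ) :
    (monomial k a : SkewTate δ r h).coeff j = if j = k then a else 0 := rfl

theorem monomial_zero_mul_coeff (a : A) (u : SkewTate δ r h) (j : ℕ) :
    (monomial 0 a * u).coeff j = a * u.coeff j := by
  rw [coeff_mul, tsum_eq_single 0]
  · simp [coeff_monomial]
  · intro i hi
    simp [coeff_monomial, hi]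

/-- The inclusion of the constants. -/
def C : A →+* SkewTate δ r h where
  toFun := monomial 0
  map_one' := rfl
  map_mul' a b := by ext j; rw [monomial_zero_mul_coeff]; simp [coeff_monomial]
  map_zero' := by ext j; simp [coeff_monomial]
  map_add' a b := by ext j; rw [coeff_add]; simp only [coeff_monomial]; split_ifs <;> simp

theorem coeff_C (a : A) (j : ℕ) : (C a : SkewTate δ r h).coeff j = if j = 0 then a else 0 := rfl

theorem coeff_C_mul (a : A) (u : SkewTate δ r h) (j : ℕ) : (C a * u).coeff j = a * u.coeff j :=
  monomial_zero_mul_coeff a u j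

/-- The element `∂`. -/
def del : SkewTate δ r h := monomial 1 1

theorem del_mul (u : SkewTate δ r h) : del * u = D u := by
  ext k
  rw [coeff_mul, tsum_eq_single 1]
  · simp [del, coeff_monomial]
  · intro i hi
    simp [del, coeff_monomial, hi]

theorem del_pow_mul (i : ℕ) (u : SkewTate δ r h) : del ^ i * u = D^[i] u := by
  induction i with
  | zero => simp
  | succ i ih => rw [pow_succ', mul_assoc, ih, del_mul, Function.iterate_succ_apply']

theorem coeff_del_pow (i k : ℕ) : ((del : SkewTate δ r h) ^ i).coeff k = if k = i then 1 else 0 := by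
  rw [← mul_one (del ^ i), del_pow_mul, coeff_D_iterate_one]

theorem monomial_eq (k : ℕ) (a : A) : (monomial k a : SkewTate δ r h) = C a * del ^ k := by
  ext j
  rw [coeff_C_mul, coeff_del_pow, coeff_monomial]
  split_ifs <;> simp

theorem del_mul_C (a : A) : (del : SkewTate δ r h) * C a = C a * del + C (δ a) := by
  ext k
  rw [del_mul, coeff_add, coeff_C_mul, ← pow_one del, coeff_del_pow, coeff_C]
  cases k with
  | zero => simp [coeff_D_zero, coeff_C]
  | succ k =>
    rw [coeff_D_succ, coeff_C, coeff_C]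
    simp

theorem norm_del_pow_mul_le (i : ℕ) (u : SkewTate δ r h) : ‖del ^ i * u‖ ≤ r ^ i * ‖u‖ := by
  rw [del_pow_mul]
  exact norm_D_iterate_le i u

theorem norm_C_mul_del_pow (a : A) (k : ℕ) :
    ‖(C a : SkewTate δ r h) * del ^ k‖ = ‖(C a : SkewTate δ r h)‖ * r ^ k := by
  have hr := h.pos
  apply le_antisymm
  · refine norm_le_of fun m j => ?_
    rw [← monomial_eq, coeff_monomial]
    split_ifs with hj
    · subst hj
      have := (C a : SkewTate δ r h).norm_iterate_le m 0
      simp only [coeff_C, if_true, pow_zero, mul_one] at this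
      calc _ ≤ (‖(C a : SkewTate δ r h)‖ * r ^ m) * r ^ j := by gcongr
        _ = _ := by ring
    · rw [iterate_map_zero, norm_zero, zero_mul]
      positivity
  · rw [← le_div_iff₀ (by positivity)]
    refine norm_le_of fun m j => ?_
    rw [coeff_C]
    split_ifs with hj
    · subst hj
      have := ((C a : SkewTate δ r h) * del ^ k).norm_iterate_le m k
      rw [← monomial_eq, coeff_monomial, if_pos rfl] at this
      rw [div_mul_eq_mul_div, le_div_iff₀ (by positivity), ← monomial_eq]
      simpa using this
    · rw [iterate_map_zero, norm_zero, zero_mul]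
      positivity

theorem exists_norm_C_le (h : IsAdmissible δ r) :
    ∃ B : ℝ, 0 ≤ B ∧ ∀ a : A, ‖(C a : SkewTate δ r h)‖ ≤ B * ‖a‖ := by
  obtain ⟨B, hB, H⟩ := exists_norm_le h
  refine ⟨B, hB, fun a => H _ _ fun j => ?_⟩
  rw [coeff_C]
  split_ifs with hj
  · simp [hj]
  · simp

theorem norm_C_coeff_mul_le (u : SkewTate δ r h) (k : ℕ) :
    ‖(C (u.coeff k) : SkewTate δ r h)‖ * r ^ k ≤ ‖u‖ := by
  have hr := h.pos
  rw [← le_div_iff₀ (by positivity)]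
  refine norm_le_of fun m j => ?_
  rw [coeff_C]
  split_ifs with hj
  · rw [hj, div_mul_eq_mul_div, le_div_iff₀ (by positivity)]
    simpa using u.norm_iterate_le m k
  · rw [iterate_map_zero, norm_zero, zero_mul]
    exact mul_nonneg (div_nonneg (norm_nonneg _) (by positivity)) (by positivity)

theorem continuous_C : Continuous (C : A →+* SkewTate δ r h) := by
  obtain ⟨B, -, hB⟩ := exists_norm_C_le h
  exact AddMonoidHomClass.continuous_of_bound _ B hB

/-- `u = ∑ uₖ ∂ᵏ`. -/
theorem hasSum_coeff (u : SkewTate δ r h) : HasSum (fun k => C (u.coeff k) * del ^ k) u := by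
  have hr := h.pos
  have hs : Summable fun k => (C (u.coeff k) : SkewTate δ r h) * del ^ k := by
    refine NonarchimedeanAddGroup.summable_of_tendsto_cofinite_zero ?_
    rw [Nat.cofinite_eq_atTop]
    obtain ⟨B, -, hB⟩ := exists_norm_C_le h
    have h1 := u.tendsto_coeff.const_mul B
    rw [mul_zero] at h1
    refine squeeze_zero_norm (fun k => ?_) h1
    rw [norm_C_mul_del_pow, ← mul_assoc]
    gcongr
    exact hB _
  convert hs.hasSum
  ext j
  have h1 := hs.hasSum.map (coeffHom j) (continuous_coeff j)
  refine (h1.unique ?_).symm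
  convert hasSum_ite_eq j (u.coeff j) using 2 with k
  change ((C (u.coeff k) : SkewTate δ r h) * del ^ k).coeff j = _
  rw [← monomial_eq, coeff_monomial]
  by_cases hjk : k = j
  · simp [hjk]
  · rw [if_neg hjk, if_neg (Ne.symm hjk)]

/-- Continuous additive maps that agree on the monomials are equal. -/
theorem addHom_ext {B : Type*} [AddCommGroup B] [TopologicalSpace B] [T2Space B]
    {f g : SkewTate δ r h →+ B} (hf : Continuous f) (hg : Continuous g)
    (H : ∀ a k, f (C a * del ^ k) = g (C a * del ^ k)) (u : SkewTate δ r h) : f u = g u := by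
  have h1 := u.hasSum_coeff.map f hf
  have h2 := u.hasSum_coeff.map g hg
  refine h1.unique ?_
  convert h2 using 1
  ext k
  exact H _ _

/-- Scalars are central because `δ` kills them; this is checked on monomials and extended by
continuity. -/
instance : Algebra K (SkewTate δ r h) :=
  RingHom.toAlgebra' (C.comp (algebraMap K A)) fun c u => by
    have hc : Continuous fun u : SkewTate δ r h => C (algebraMap K A c) * u :=
      continuous_const.mul continuous_id
    have hc' : Continuous fun u : SkewTate δ r h => u * C (algebraMap K A c) :=
      continuous_id.mul continuous_const
    refine addHom_ext (f := AddMonoidHom.mulLeft (C (algebraMap K A c)))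
      (g := AddMonoidHom.mulRight (C (algebraMap K A c))) hc hc' (fun a k => ?_) u
    change C (algebraMap K A c) * (C a * del ^ k) = C a * del ^ k * C (algebraMap K A c)
    have hcomm : ((del : SkewTate δ r h) ^ k) * C (algebraMap K A c) =
        C (algebraMap K A c) * del ^ k := by
      refine (Commute.pow_left ?_ k).eq
      change del * _ = _
      rw [del_mul_C, Derivation.map_algebraMap, map_zero, add_zero]
    rw [mul_assoc, hcomm, ← mul_assoc, ← mul_assoc, ← map_mul, ← map_mul, mul_comm a]

theorem smul_eq (c : K) (u : SkewTate δ r h) : c • u = C (algebraMap K A c) * u := rfl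

theorem coeff_smul (c : K) (u : SkewTate δ r h) (j : ℕ) : (c • u).coeff j = c • u.coeff j := by
  rw [smul_eq, coeff_C_mul, ← Algebra.smul_def]

theorem iterate_smul (c : K) (m : ℕ) (a : A) : δ^[m] (c • a) = c • δ^[m] a := by
  induction m generalizing a with
  | zero => rfl
  | succ m ih => rw [Function.iterate_succ_apply, Derivation.map_smul, ih]; rfl

instance : NormedAlgebra K (SkewTate δ r h) where
  norm_smul_le c u := by
    have hr := h.pos
    refine norm_le_of fun m j => ?_
    rw [coeff_smul, iterate_smul, mul_assoc]
    calc _ ≤ ‖c‖ * ‖δ^[m] (u.coeff j)‖ * r ^ j := by gcongr; exact norm_smul_le _ _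
      _ = ‖c‖ * (‖δ^[m] (u.coeff j)‖ * r ^ j) := by ring
      _ ≤ _ := mul_le_mul_of_nonneg_left (u.norm_iterate_le m j) (norm_nonneg _)

end SkewTate

/-! ### The opposite of a skew-Tate algebra -/

section Neg

variable {K : Type u} [NontriviallyNormedField K]
variable {A : Type u} [NormedCommRing A] [NormedAlgebra K A]

theorem norm_iterate_of_eq_neg {δ δ' : Derivation K A A} (hδ : ∀ a, δ' a = -δ a) (m : ℕ) (a : A) :
    ‖δ'^[m] a‖ = ‖δ^[m] a‖ := by
  induction m generalizing a with
  | zero => rfl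
  | succ m ih =>
    rw [Function.iterate_succ_apply, Function.iterate_succ_apply, hδ, iterate_map_neg, norm_neg,
      ih]

theorem enorm_neg_pow_apply (δ : Derivation K A A) (k : ℕ) (a : A) :
    ‖(((-δ : Derivation K A A) : A →ₗ[K] A) ^ k) a‖ₑ = ‖((δ : A →ₗ[K] A) ^ k) a‖ₑ := by
  rw [Module.End.pow_apply, Module.End.pow_apply, ← ofReal_norm, ← ofReal_norm]
  exact congrArg _ (norm_iterate_of_eq_neg (fun _ => rfl) k a)

theorem IsAdmissible.neg {δ : Derivation K A A} {r : ℝ} (h : IsAdmissible δ r) :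
    IsAdmissible (-δ) r := by
  refine ⟨h.1.neg, ?_⟩
  have h1 : opSpectralRadius ((-δ : Derivation K A A) : A →ₗ[K] A) =
      opSpectralRadius (δ : A →ₗ[K] A) := by
    simp only [opSpectralRadius, opNorm, enorm_neg_pow_apply]
  rw [h1]
  exact h.2

end Neg

namespace SkewTate

variable {K : Type u} [NontriviallyNormedField K]
variable {A : Type u} [NormedCommRing A] [NormedAlgebra K A]
variable {δ δ' : Derivation K A A} {r : ℝ} {h : IsAdmissible δ r} {h' : IsAdmissible δ' r}

variable [IsUltrametricDist A] [CompleteSpace A]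

theorem norm_C_neg (hδ : ∀ a, δ' a = -δ a) (a : A) :
    ‖(C a : SkewTate δ' r h')‖ = ‖(C a : SkewTate δ r h)‖ := by
  rw [norm_def, norm_def]
  congr 1
  ext p
  rw [coeff_C, coeff_C, norm_iterate_of_eq_neg hδ]

theorem norm_reverse_term_le (hδ : ∀ a, δ' a = -δ a) (u : SkewTate δ r h) (k : ℕ) :
    ‖(del : SkewTate δ' r h') ^ k * C (u.coeff k)‖ ≤ ‖u‖ := by
  refine (norm_del_pow_mul_le k _).trans ?_
  rw [norm_C_neg (h := h) hδ, mul_comm]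
  exact u.norm_C_coeff_mul_le k

theorem summable_reverse (u : SkewTate δ r h) :
    Summable fun k => (del : SkewTate δ' r h') ^ k * C (u.coeff k) := by
  have hr := h.pos
  refine NonarchimedeanAddGroup.summable_of_tendsto_cofinite_zero ?_
  rw [Nat.cofinite_eq_atTop]
  obtain ⟨B, -, hB⟩ := exists_norm_C_le h'
  have h1 := u.tendsto_coeff.const_mul B
  rw [mul_zero] at h1
  refine squeeze_zero_norm (fun k => ?_) h1
  refine (norm_del_pow_mul_le k _).trans ?_
  calc _ ≤ r ^ k * (B * ‖u.coeff k‖) := by gcongr; exact hB _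
    _ = _ := by ring

variable (h h') in
/-- The additive map `∑ aₖ ∂ᵏ ↦ ∑ ∂ᵏ aₖ`. -/
def reverse : SkewTate δ r h →+ SkewTate δ' r h' :=
  AddMonoidHom.mk' (fun u => ∑' k, del ^ k * C (u.coeff k)) fun u v => by
    rw [← (summable_reverse u).tsum_add (summable_reverse v)]
    simp only [coeff_add, map_add, mul_add]

theorem reverse_apply (u : SkewTate δ r h) :
    reverse h h' u = ∑' k, del ^ k * C (u.coeff k) := rfl

theorem continuous_reverse (hδ : ∀ a, δ' a = -δ a) : Continuous (reverse h h') := by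
  refine AddMonoidHomClass.continuous_of_bound _ 1 fun u => ?_
  rw [one_mul, reverse_apply]
  exact IsUltrametricDist.norm_tsum_le_of_forall_le_of_nonneg (norm_nonneg _)
    fun k => norm_reverse_term_le hδ u k

theorem reverse_C_mul_del_pow (a : A) (k : ℕ) :
    reverse h h' (C a * del ^ k) = del ^ k * C a := by
  rw [reverse_apply, tsum_eq_single k]
  · rw [← monomial_eq, coeff_monomial, if_pos rfl]
  · intro j hj
    rw [← monomial_eq, coeff_monomial, if_neg hj, map_zero, mul_zero]

theorem reverse_C (a : A) : reverse h h' (C a) = C a := by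
  simpa using reverse_C_mul_del_pow (h := h) (h' := h') a 0

theorem reverse_del_pow (k : ℕ) : reverse h h' (del ^ k) = del ^ k := by
  simpa using reverse_C_mul_del_pow (h := h) (h' := h') 1 k

theorem reverse_C_mul (hδ : ∀ a, δ' a = -δ a) (a : A) (u : SkewTate δ r h) :
    reverse h h' (C a * u) = reverse h h' u * C a := by
  have hc := continuous_reverse (h := h) (h' := h') hδ
  refine addHom_ext (f := (reverse h h').comp (AddMonoidHom.mulLeft (C a)))
    (g := (AddMonoidHom.mulRight (C a)).comp (reverse h h'))
    (hc.comp (continuous_const.mul continuous_id)) (hc.mul continuous_const) (fun b k => ?_) u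
  change reverse h h' (C a * (C b * del ^ k)) = reverse h h' (C b * del ^ k) * C a
  rw [← mul_assoc, ← map_mul, reverse_C_mul_del_pow, reverse_C_mul_del_pow, mul_assoc, ← map_mul,
    mul_comm a b]

/-- The sign change enters here. In the target `∂ b = b ∂ - δ(b)`, so the image `∂^(k+1) b + ∂^k
δ(b)` of `∂ b ∂^k` collapses to `∂^k b ∂`. -/
theorem reverse_del_mul (hδ : ∀ a, δ' a = -δ a) (u : SkewTate δ r h) :
    reverse h h' (del * u) = reverse h h' u * del := by
  have hc := continuous_reverse (h := h) (h' := h') hδ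
  refine addHom_ext (f := (reverse h h').comp (AddMonoidHom.mulLeft del))
    (g := (AddMonoidHom.mulRight del).comp (reverse h h'))
    (hc.comp (continuous_const.mul continuous_id)) (hc.mul continuous_const) (fun b k => ?_) u
  change reverse h h' (del * (C b * del ^ k)) = reverse h h' (C b * del ^ k) * del
  rw [← mul_assoc, del_mul_C, add_mul, mul_assoc, ← pow_succ', map_add, reverse_C_mul_del_pow,
    reverse_C_mul_del_pow, reverse_C_mul_del_pow, pow_succ, mul_assoc, del_mul_C, hδ, map_neg,
    mul_assoc, mul_add]
  simp

theorem reverse_del_pow_mul (hδ : ∀ a, δ' a = -δ a) (k : ℕ) (u : SkewTate δ r h) :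
    reverse h h' (del ^ k * u) = reverse h h' u * del ^ k := by
  induction k generalizing u with
  | zero => simp
  | succ k ih => rw [pow_succ, mul_assoc, ih, reverse_del_mul hδ, mul_assoc, ← pow_succ']

theorem reverse_mul (hδ : ∀ a, δ' a = -δ a) (u v : SkewTate δ r h) :
    reverse h h' (u * v) = reverse h h' v * reverse h h' u := by
  have hc := continuous_reverse (h := h) (h' := h') hδ
  refine addHom_ext (f := (reverse h h').comp (AddMonoidHom.mulRight v))
    (g := (AddMonoidHom.mulLeft (reverse h h' v)).comp (reverse h h'))
    (hc.comp (continuous_id.mul continuous_const)) (continuous_const.mul hc) (fun a k => ?_) u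
  change reverse h h' (C a * del ^ k * v) = reverse h h' v * reverse h h' (C a * del ^ k)
  rw [mul_assoc, reverse_C_mul hδ, reverse_del_pow_mul hδ, reverse_C_mul_del_pow, mul_assoc]

/-- Since reversal is antimultiplicative, it turns `∂^k a` back into `a ∂^k`; continuity does the
rest. -/
theorem reverse_reverse (hδ : ∀ a, δ' a = -δ a) (u : SkewTate δ r h) :
    reverse h' h (reverse h h' u) = u := by
  have hδ' : ∀ a, δ a = -δ' a := fun a => by rw [hδ, neg_neg]
  refine addHom_ext (f := (reverse h' h).comp (reverse h h')) (g := AddMonoidHom.id _)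
    ((continuous_reverse hδ').comp (continuous_reverse hδ)) continuous_id (fun a k => ?_) u
  change reverse h' h (reverse h h' (C a * del ^ k)) = C a * del ^ k
  rw [reverse_C_mul_del_pow, reverse_mul hδ', reverse_C, reverse_del_pow]

variable (h) in
/-- The opposite of `A⟨∂/r⟩` is the skew-Tate algebra of the opposite derivation. -/
def reverseRingHom : SkewTate (-δ) r h.neg →+* (SkewTate δ r h)ᵐᵒᵖ where
  toFun u := MulOpposite.op (reverse h.neg h u)
  map_zero' := by simp
  map_one' := by rw [← pow_zero del, reverse_del_pow, pow_zero, MulOpposite.op_one]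
  map_add' u v := by simp
  map_mul' u v := by
    rw [reverse_mul (δ := -δ) (fun a => (neg_neg (δ a)).symm), MulOpposite.op_mul]

theorem reverseRingHom_surjective : Function.Surjective (reverseRingHom h) := fun v =>
  ⟨reverse h h.neg v.unop, by
    change MulOpposite.op (reverse h.neg h (reverse h h.neg v.unop)) = v
    rw [reverse_reverse fun a => rfl, MulOpposite.op_unop]⟩

end SkewTate

/-! ### Expansions of the elements of an affinoid algebra -/

section Expansion

variable {K : Type u} [NontriviallyNormedField K] [IsUltrametricDist K]

theorem gaussNorm_le {n : ℕ} {f : MvPowerSeries (Fin n) K} {c : ℝ}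
    (hf : ∀ d, ‖MvPowerSeries.coeff d f‖ ≤ c) : gaussNorm f ≤ c := ciSup_le hf

/-- The element of the Tate algebra with given coefficients. -/
def tateMk {n : ℕ} (f : (Fin n →₀ ℕ) → K) (hf : Tendsto f cofinite (𝓝 0)) : TateAlgebra K n :=
  ⟨f, (mem_tate_iff _).2 (tendsto_zero_iff_norm_tendsto_zero.1 hf)⟩

theorem coeff_tateMk {n : ℕ} (f : (Fin n →₀ ℕ) → K) (hf : Tendsto f cofinite (𝓝 0))
    (d : Fin n →₀ ℕ) :
    MvPowerSeries.coeff d (tateMk f hf : MvPowerSeries (Fin n) K) = f d := rfl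

/-- The monomials of the Tate algebra. -/
def tateMonomial {n : ℕ} (α : Fin n →₀ ℕ) : TateAlgebra K n :=
  ⟨MvPowerSeries.monomial α 1, by
    classical
    rw [mem_tate_iff]
    refine tendsto_const_nhds.congr' ?_
    filter_upwards [(Set.finite_singleton α).compl_mem_cofinite] with d hd
    rw [MvPowerSeries.coeff_monomial, if_neg (by simpa using hd), norm_zero]⟩

theorem coeff_tateMonomial {n : ℕ} [DecidableEq (Fin n →₀ ℕ)] (α d : Fin n →₀ ℕ) :
    MvPowerSeries.coeff d ((tateMonomial α : TateAlgebra K n) : MvPowerSeries (Fin n) K) = if d = α then 1 else 0 := by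
  change MvPowerSeries.coeff d (MvPowerSeries.monomial α 1) = _
  rw [MvPowerSeries.coeff_monomial]
  split_ifs <;> rfl

theorem tateMonomial_add {n : ℕ} (α β : Fin n →₀ ℕ) :
    (tateMonomial (α + β) : TateAlgebra K n) = tateMonomial α * tateMonomial β :=
  Subtype.ext (by
    change MvPowerSeries.monomial (α + β) 1 = MvPowerSeries.monomial α 1 * MvPowerSeries.monomial β 1
    rw [MvPowerSeries.monomial_mul_monomial, one_mul])

variable {A : Type u} [NormedCommRing A] [NormedAlgebra K A] [CompleteSpace A]

/-- The tails of a restricted power series have small Gauss norm, and `π` is bounded for that norm.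
-/
theorem hasSum_tateMk {n : ℕ} (π : TateAlgebra K n →ₐ[K] A) {B : ℝ}
    (hπ : ∀ f : TateAlgebra K n, ‖π f‖ ≤ B * gaussNorm (f : MvPowerSeries (Fin n) K))
    (f : (Fin n →₀ ℕ) → K) (hf : Tendsto f cofinite (𝓝 0)) :
    HasSum (fun α => f α • π (tateMonomial α)) (π (tateMk f hf)) := by
  classical
  rw [HasSum, SummationFilter.unconditional_filter, Metric.tendsto_atTop]
  intro ε hε
  set η := ε / (|B| + 1) with hη
  have hη0 : 0 < η := by positivity
  have hfin := (Metric.tendsto_nhds.1 hf) η hη0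
  rw [eventually_cofinite] at hfin
  refine ⟨hfin.toFinset, fun F hF => ?_⟩
  have h1 : ∑ α ∈ F, f α • π (tateMonomial α) = π (∑ α ∈ F, f α • tateMonomial α) := by
    simp [map_sum]
  rw [dist_comm, dist_eq_norm, h1, ← map_sub]
  have hco : ∀ d, MvPowerSeries.coeff d ((tateMk f hf - ∑ α ∈ F, f α • tateMonomial α :
      TateAlgebra K n) : MvPowerSeries (Fin n) K) = if d ∈ F then 0 else f d := by
    intro d
    have h2 : ((tateMk f hf - ∑ α ∈ F, f α • tateMonomial α : TateAlgebra K n) :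
        MvPowerSeries (Fin n) K) = (tateMk f hf : MvPowerSeries (Fin n) K) -
          ∑ α ∈ F, f α • ((tateMonomial α : TateAlgebra K n) : MvPowerSeries (Fin n) K) := by
      simp
    rw [h2, map_sub, coeff_tateMk, map_sum]
    simp only [MvPowerSeries.coeff_smul, coeff_tateMonomial]
    split_ifs with hd <;> simp [hd]
  have h3 : gaussNorm ((tateMk f hf - ∑ α ∈ F, f α • tateMonomial α :
      TateAlgebra K n) : MvPowerSeries (Fin n) K) ≤ η := by
    refine gaussNorm_le fun d => ?_
    rw [hco]
    split_ifs with hd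
    · simpa using hη0.le
    · by_contra hc
      refine hd (hF ?_)
      rw [Set.Finite.mem_toFinset]
      simpa using (not_le.1 hc).le
  refine (hπ _).trans_lt ?_
  calc B * _ ≤ |B| * η := mul_le_mul (le_abs_self B) h3 (gaussNorm_nonneg _) (abs_nonneg B)
    _ < (|B| + 1) * η := by nlinarith
    _ = ε := by rw [hη]; field_simp

/-- This is the open mapping theorem, applied to the Banach space of coefficient families tending to
zero. -/
theorem exists_bounded_preimage [CompleteSpace K] {n : ℕ} (π : TateAlgebra K n →ₐ[K] A)
    (hs : Function.Surjective π) {B : ℝ}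
    (hπ : ∀ f : TateAlgebra K n, ‖π f‖ ≤ B * gaussNorm (f : MvPowerSeries (Fin n) K)) :
    ∃ C : ℝ, 0 ≤ C ∧ ∀ a : A, ∃ (f : (Fin n →₀ ℕ) → K) (hf : Tendsto f cofinite (𝓝 0)),
      π (tateMk f hf) = a ∧ ∀ d, ‖f d‖ ≤ C * ‖a‖ := by
  -- For the discrete topology on exponents, vanishing at infinity means tending to zero along
  -- `cofinite`.
  let _ : TopologicalSpace (Fin n →₀ ℕ) := ⊥
  have _ : DiscreteTopology (Fin n →₀ ℕ) := ⟨rfl⟩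
  have hlim : ∀ f : ZeroAtInftyContinuousMap (Fin n →₀ ℕ) K, Tendsto f cofinite (𝓝 0) := fun f => by
    have := f.zero_at_infty'
    rwa [cocompact_eq_cofinite] at this
  have hle : ∀ (f : ZeroAtInftyContinuousMap (Fin n →₀ ℕ) K) d, ‖f d‖ ≤ ‖f‖ := fun f d =>
    f.toBCF.norm_coe_le_norm d
  let Φ : ZeroAtInftyContinuousMap (Fin n →₀ ℕ) K →ₗ[K] A :=
    π.toLinearMap ∘ₗ
      { toFun := fun f => tateMk f (hlim f)
        map_add' := fun f g => rfl
        map_smul' := fun c f => rfl }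
  have hΦ : ∀ f, ‖Φ f‖ ≤ |B| * ‖f‖ := fun f =>
    (hπ _).trans (mul_le_mul (le_abs_self B) (gaussNorm_le fun d => hle f d) (gaussNorm_nonneg _)
      (abs_nonneg B))
  let Ψ := Φ.mkContinuous |B| hΦ
  have hsurj : Function.Surjective Ψ := by
    intro a
    obtain ⟨f, rfl⟩ := hs a
    have hf : Tendsto (fun d => MvPowerSeries.coeff d (f : MvPowerSeries (Fin n) K)) cofinite
        (𝓝 0) := tendsto_zero_iff_norm_tendsto_zero.2 ((mem_tate_iff _).1 f.2)
    refine ⟨⟨⟨fun d => MvPowerSeries.coeff d (f : MvPowerSeries (Fin n) K),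
      continuous_of_discreteTopology⟩, by rw [cocompact_eq_cofinite]; exact hf⟩, ?_⟩
    change π (tateMk _ hf) = π f
    congr 1
  obtain ⟨C, hC, H⟩ := Ψ.exists_preimage_norm_le hsurj
  refine ⟨C, hC.le, fun a => ?_⟩
  obtain ⟨f, hf, hfa⟩ := H a
  exact ⟨f, hlim f, hf, fun d => (hle f d).trans hfa⟩

/-- Elements of an affinoid algebra have expansions in bounded monomials, with coefficients
controlled by the norm. -/
theorem IsAffinoid.exists_expansion [CompleteSpace K] (hA : IsAffinoid K A) :
    ∃ (n : ℕ) (X : (Fin n →₀ ℕ) → A) (B C : ℝ), 0 ≤ C ∧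
      (∀ α β, X (α + β) = X α * X β) ∧ (∀ α, ‖X α‖ ≤ B) ∧
      ∀ a : A, ∃ f : (Fin n →₀ ℕ) → K, Tendsto f cofinite (𝓝 0) ∧
        HasSum (fun α => f α • X α) a ∧ ∀ α, ‖f α‖ ≤ C * ‖a‖ := by
  classical
  obtain ⟨n, π, hs, B, hB⟩ := hA
  obtain ⟨C, hC, H⟩ := exists_bounded_preimage π hs hB
  refine ⟨n, fun α => π (tateMonomial α), |B|, C, hC, fun α β => ?_, fun α => ?_, fun a => ?_⟩
  · simp only [tateMonomial_add, map_mul]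
  · refine (hB _).trans ?_
    have h1 : gaussNorm ((tateMonomial α : TateAlgebra K n) : MvPowerSeries (Fin n) K) ≤ 1 :=
      gaussNorm_le fun d => by rw [coeff_tateMonomial]; split_ifs <;> simp
    calc _ ≤ |B| * 1 := mul_le_mul (le_abs_self B) h1 (gaussNorm_nonneg _) (abs_nonneg B)
      _ = _ := mul_one _
  · obtain ⟨f, hf, rfl, hfa⟩ := H a
    exact ⟨f, hf, hasSum_tateMk π hB f hf, hfa⟩

end Expansion

/-! ### Powers of `∂` that almost commute with the constants -/

/-- From `m * choose N m = N * choose (N - 1) (m - 1)`, the `p`-adic valuation of the binomial is at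
least that of `N` minus that of `m`. -/
theorem pow_dvd_choose {p : ℕ} (hp : p.Prime) {a b N m : ℕ} (hN : p ^ (a + b) ∣ N) (hm : m ≠ 0)
    (hb : ¬ p ^ b ∣ m) : p ^ a ∣ N.choose m := by
  obtain ⟨v, m', hm', rfl⟩ := Nat.exists_eq_pow_mul_and_not_dvd hm p hp.ne_one
  have hv : v ≤ b := by
    by_contra hc
    exact hb (Dvd.dvd.mul_right (pow_dvd_pow p (not_le.1 hc).le) m')
  rcases Nat.eq_zero_or_pos N with rfl | hN0
  · rw [Nat.choose_eq_zero_of_lt (Nat.pos_of_ne_zero hm)]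
    exact dvd_zero _
  have h1 : p ^ (a + b) ∣ N.choose (p ^ v * m') * p ^ v * m' := by
    obtain ⟨N, rfl⟩ := Nat.exists_eq_succ_of_ne_zero hN0.ne'
    obtain ⟨m, hm2⟩ := Nat.exists_eq_succ_of_ne_zero hm
    rw [mul_assoc, hm2, Nat.succ_eq_add_one, Nat.succ_eq_add_one, ← Nat.add_one_mul_choose_eq]
    exact hN.mul_right _
  have hcop : Nat.Coprime (p ^ (a + b)) m' :=
    Nat.Coprime.pow_left _ ((Nat.Prime.coprime_iff_not_dvd hp).2 hm')
  have h2 := hcop.dvd_of_dvd_mul_right h1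
  have h3 : p ^ a * p ^ v ∣ N.choose (p ^ v * m') * p ^ v := by
    rw [← pow_add]
    exact (pow_dvd_pow p (by omega)).trans h2
  exact Nat.dvd_of_mul_dvd_mul_right (pow_pos hp.pos v) h3

namespace SkewTate

variable {K : Type u} [NontriviallyNormedField K] [IsUltrametricDist K]
variable {A : Type u} [NormedCommRing A] [NormedAlgebra K A]
variable {δ : Derivation K A A} {r : ℝ} {h : IsAdmissible δ r}

/-- The gap between the spectral radius and `r` leaves room for an `s < r`; this is what makes high
derivatives negligible against `r ^ m`. -/
theorem exists_strict_bound (h : IsAdmissible δ r) : ∃ s B : ℝ, 0 < s ∧ s < r ∧ 0 ≤ B ∧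
    ∀ (m : ℕ) (a : A), ‖δ^[m] a‖ ≤ B * s ^ m * ‖a‖ := by
  obtain ⟨s, hs0, hs1, hs2⟩ := ENNReal.lt_iff_exists_real_btwn.1 h.2
  have h' : IsAdmissible δ s := ⟨h.1, hs1⟩
  obtain ⟨B, hB0, hB⟩ := h'.exists_bound
  exact ⟨s, B, h'.pos, (ENNReal.ofReal_lt_ofReal_iff h.pos).1 hs2, hB0, hB⟩

theorem exists_small_choose {p : ℕ} (hp : p.Prime) (hpK : ‖(p : K)‖ < 1) (h : IsAdmissible δ r)
    {η : ℝ} (hη : 0 < η) : ∃ k : ℕ, ∀ N, p ^ k ∣ N → ∀ m, m ≠ 0 → ∀ a : A,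
      ‖(N.choose m : K) • δ^[m] a‖ ≤ η * r ^ m * ‖a‖ := by
  have hr := h.pos
  obtain ⟨s, B, hs0, hsr, hB0, hB⟩ := exists_strict_bound h
  have hB' : ∀ (m : ℕ) (a : A), ‖δ^[m] a‖ ≤ B * r ^ m * ‖a‖ := fun m a =>
    (hB m a).trans (by gcongr)
  have h1 := (tendsto_pow_atTop_nhds_zero_of_lt_one (norm_nonneg _) hpK).mul_const B
  have h2 := (tendsto_pow_atTop_nhds_zero_of_lt_one (by positivity) ((div_lt_one hr).2 hsr)).mul_const B
  rw [zero_mul] at h1 h2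
  -- The exponent `a` makes `‖p‖ ^ a` small enough, for `m` not divisible by `p ^ b`. The exponent
  -- `b` makes `(s / r) ^ m` small enough once `m ≥ b`, which holds when `p ^ b` divides `m ≠ 0`.
  obtain ⟨a, ha⟩ := (h1.eventually (gt_mem_nhds hη)).exists
  obtain ⟨b, hb⟩ := eventually_atTop.1 (h2.eventually (gt_mem_nhds hη))
  refine ⟨a + b, fun N hN m hm y => ?_⟩
  by_cases hbm : p ^ b ∣ m
  · have hbm' : b ≤ m := (Nat.lt_pow_self hp.one_lt).le.trans (Nat.le_of_dvd (by omega) hbm)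
    calc _ ≤ ‖(N.choose m : K)‖ * ‖δ^[m] y‖ := norm_smul_le _ _
      _ ≤ 1 * (B * s ^ m * ‖y‖) :=
        mul_le_mul (IsUltrametricDist.norm_natCast_le_one K _) (hB m y) (norm_nonneg _) zero_le_one
      _ = (s / r) ^ m * B * r ^ m * ‖y‖ := by rw [div_pow]; field_simp
      _ ≤ _ := by gcongr; exact (hb m hbm').le
  · obtain ⟨c, hc⟩ := pow_dvd_choose hp hN hm hbm
    have hcK : ‖(N.choose m : K)‖ ≤ ‖(p : K)‖ ^ a := by
      rw [hc, Nat.cast_mul, Nat.cast_pow, norm_mul, norm_pow]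
      exact mul_le_of_le_one_right (by positivity) (IsUltrametricDist.norm_natCast_le_one K _)
    calc _ ≤ ‖(N.choose m : K)‖ * ‖δ^[m] y‖ := norm_smul_le _ _
      _ ≤ ‖(p : K)‖ ^ a * (B * r ^ m * ‖y‖) :=
        mul_le_mul hcK (hB' m y) (norm_nonneg _) (by positivity)
      _ = ‖(p : K)‖ ^ a * B * r ^ m * ‖y‖ := by ring
      _ ≤ _ := by gcongr

variable [IsUltrametricDist A] [CompleteSpace A]

theorem coeff_del_pow_mul_C (N : ℕ) (a : A) (k : ℕ) :
    ((del : SkewTate δ r h) ^ N * C a).coeff k =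
      if k ≤ N then (N.choose (N - k) : K) • δ^[N - k] a else 0 := by
  rw [del_pow_mul, coeff_D_iterate, dmul_iterate_apply]
  split_ifs with hk
  · rw [Finset.sum_eq_single (N - k)]
    · rw [if_pos (by omega), coeff_C, if_pos (by omega), Algebra.smul_def, map_natCast]
    · intro m hm hne
      split_ifs with hN
      · rw [coeff_C, if_neg (by omega), iterate_map_zero, mul_zero]
      · rfl
    · intro hN
      exact absurd (Finset.mem_range.2 (by omega)) hN
  · refine Finset.sum_eq_zero fun m hm => ?_
    split_ifs with hN
    · rw [coeff_C, if_neg (by omega), iterate_map_zero, mul_zero]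
    · rfl

/-- Subtracting `a ∂^N` removes the term `m = 0` of the Leibniz expansion of `∂^N a`, and
`exists_small_choose` bounds every other term. -/
theorem exists_small_commutator {p : ℕ} (hp : p.Prime) (hpK : ‖(p : K)‖ < 1)
    (h : IsAdmissible δ r) {η : ℝ} (hη : 0 < η) :
    ∃ k : ℕ, ∀ N, p ^ k ∣ N → ∀ a : A,
      ‖(del : SkewTate δ r h) ^ N * C a - C a * del ^ N‖ ≤
        η * r ^ N * ‖(C a : SkewTate δ r h)‖ := by
  have hr := h.pos
  obtain ⟨k, hk⟩ := exists_small_choose hp hpK h hη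
  refine ⟨k, fun N hN a => norm_le_of fun l j => ?_⟩
  rw [coeff_sub, coeff_del_pow_mul_C, coeff_C_mul, coeff_del_pow]
  rcases lt_trichotomy j N with hj | hj | hj
  -- The iterates of `δ` are swapped so that `exists_small_choose` applies to `δ^[l] a`, whose size
  -- is already controlled by the norm of `C a`.
  · rw [if_pos hj.le, if_neg hj.ne, mul_zero, sub_zero, iterate_smul,
      ← Function.iterate_add_apply, add_comm, Function.iterate_add_apply]
    have h1 := (C a : SkewTate δ r h).norm_iterate_le l 0
    rw [coeff_C, if_pos rfl, pow_zero, mul_one] at h1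
    calc _ ≤ η * r ^ (N - j) * ‖δ^[l] a‖ * r ^ j := by
          gcongr
          exact hk N hN (N - j) (by omega) _
      _ ≤ η * r ^ (N - j) * (‖(C a : SkewTate δ r h)‖ * r ^ l) * r ^ j := by gcongr
      _ = η * (r ^ (N - j) * r ^ j) * ‖(C a : SkewTate δ r h)‖ * r ^ l := by ring
      _ = _ := by rw [← pow_add, Nat.sub_add_cancel hj.le]
  · rw [if_pos hj.le, if_pos hj, hj]
    simp only [Nat.sub_self, Nat.choose_zero_right, Nat.cast_one, one_smul, mul_one,
      Function.iterate_zero, id, sub_self, iterate_map_zero, norm_zero, zero_mul]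
    positivity
  · rw [if_neg (by omega), if_neg hj.ne', mul_zero, sub_zero, iterate_map_zero, norm_zero, zero_mul]
    positivity

end SkewTate

/-! ### Finite bases of sets of exponents -/

/-- The minimal elements form an antichain, hence a finite set, and every element of `S` lies above
one of them. -/
theorem exists_finset_le {M : Type*} [PartialOrder M] [WellQuasiOrderedLE M] (S : Set M) :
    ∃ F : Finset M, ↑F ⊆ S ∧ ∀ x ∈ S, ∃ y ∈ F, y ≤ x := by
  have hfin : {x | Minimal (· ∈ S) x}.Finite :=
    WellQuasiOrderedLE.finite_of_isAntichain (setOfPred_minimal_antichain _)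
  refine ⟨hfin.toFinset, fun x hx => ?_, fun x hx => ?_⟩
  · have : Minimal (· ∈ S) x := by simpa using hx
    exact this.1
  · obtain ⟨y, hyx, hy⟩ := (Set.isPWO_of_wellQuasiOrderedLE S).exists_le_minimal hx
    exact ⟨y, by simpa using hy, hyx⟩

/-- Dickson's lemma is applied separately in each residue class modulo `q` of the first coordinate.
-/
theorem exists_finite_basis_shift {n q : ℕ} (hq : 0 < q) (T : Set (ℕ × (Fin n →₀ ℕ))) :
    ∃ F : Finset (ℕ × (Fin n →₀ ℕ)), ↑F ⊆ T ∧
      ∀ ν ∈ T, ∃ μ ∈ F, ∃ g : ℕ × (Fin n →₀ ℕ), (μ.1 + q * g.1, μ.2 + g.2) = ν := by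
  classical
  choose F hFT hF using fun i : ℕ =>
    exists_finset_le {x : ℕ × (Fin n →₀ ℕ) | (i + q * x.1, x.2) ∈ T}
  refine ⟨(Finset.range q).biUnion fun i => (F i).image fun x => (i + q * x.1, x.2), ?_, ?_⟩
  · intro x hx
    simp only [Finset.coe_biUnion, Finset.coe_image, Set.mem_iUnion, Set.mem_image] at hx
    obtain ⟨i, -, y, hy, rfl⟩ := hx
    exact hFT i hy
  · rintro ⟨k, α⟩ hν
    obtain ⟨y, hy, hle⟩ := hF (k % q) (k / q, α) (by
      change (k % q + q * (k / q), α) ∈ T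
      rwa [Nat.mod_add_div])
    refine ⟨(k % q + q * y.1, y.2), ?_, (k / q - y.1, α - y.2), ?_⟩
    · simp only [Finset.mem_biUnion, Finset.mem_image]
      exact ⟨k % q, Finset.mem_range.2 (Nat.mod_lt _ hq), y, hy, rfl⟩
    · have h1 : y.1 ≤ k / q := hle.1
      have h2 : y.2 ≤ α := hle.2
      refine Prod.ext ?_ (add_tsub_cancel_of_le h2)
      change k % q + q * y.1 + q * (k / q - y.1) = k
      rw [add_assoc, ← mul_add, Nat.add_sub_cancel' h1, Nat.mod_add_div]

/-! ### Scalars of prescribed size -/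

/-- Powers of `r` need not be values of `K`, so they are rounded up to powers of `ϖ`, losing at most
`‖ϖ‖`. Rounding only the residues modulo `q` and extending by powers of `c` makes the recursion
exact. -/
theorem exists_scalar_sequence {K : Type u} [NontriviallyNormedField K] {ϖ : K} (hϖ : 1 < ‖ϖ‖)
    {r : ℝ} (hr : 0 < r) {q : ℕ} (hq : 0 < q) {c : K} (hc : r ^ q = ‖c‖) :
    ∃ d : ℕ → K, (∀ k, r ^ k ≤ ‖d k‖) ∧ (∀ k, ‖d k‖ ≤ ‖ϖ‖ * r ^ k) ∧
      ∀ k t, d (k + q * t) = c ^ t * d k := by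
  have hex : ∀ i : ℕ, ∃ e : K, r ^ i ≤ ‖e‖ ∧ ‖e‖ ≤ ‖ϖ‖ * r ^ i := by
    intro i
    obtain ⟨z, hz1, hz2⟩ := exists_mem_Ico_zpow (pow_pos hr i) hϖ
    refine ⟨ϖ ^ (z + 1), by rw [norm_zpow]; exact hz2.le, ?_⟩
    rw [norm_zpow, zpow_add_one₀ (by positivity), mul_comm]
    gcongr
  choose e he1 he2 using hex
  have hpow : ∀ k, r ^ k = ‖c‖ ^ (k / q) * r ^ (k % q) := fun k => by
    rw [← hc, ← pow_mul, ← pow_add, Nat.div_add_mod]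
  refine ⟨fun k => c ^ (k / q) * e (k % q), fun k => ?_, fun k => ?_,
    fun k t => ?_⟩
  · rw [norm_mul, norm_pow, hpow k]
    gcongr
    exact he1 _
  · rw [norm_mul, norm_pow, hpow k, mul_left_comm]
    gcongr
    exact he2 _
  · beta_reduce
    rw [Nat.add_mul_mod_self_left, Nat.add_mul_div_left _ _ hq, pow_add]
    ring

/-! ### Noetherianity of skew-Tate algebras over affinoid algebras -/

namespace SkewTate

variable {K : Type u} [NontriviallyNormedField K] [IsUltrametricDist K]
variable {A : Type u} [NormedCommRing A] [NormedAlgebra K A]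
variable {δ : Derivation K A A} {r : ℝ} {h : IsAdmissible δ r}
variable [IsUltrametricDist A] [CompleteSpace A]

theorem norm_del_pow_le (k : ℕ) : ‖(del : SkewTate δ r h) ^ k‖ ≤ r ^ k * ‖(1 : SkewTate δ r h)‖ := by
  simpa using norm_del_pow_mul_le (h := h) k 1

/-- Expansions in `A` yield expansions in the skew-Tate algebra. -/
theorem exists_expansion {J : Type*} {X : J → A} {B C₀ Θ : ℝ} (hC₀ : 0 ≤ C₀) (hΘ : 0 ≤ Θ)
    (hX : ∀ α, ‖X α‖ ≤ B)
    (hexp : ∀ a : A, ∃ f : J → K, Tendsto f cofinite (𝓝 0) ∧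
      HasSum (fun α => f α • X α) a ∧ ∀ α, ‖f α‖ ≤ C₀ * ‖a‖)
    {d : ℕ → K} (hd : ∀ k, r ^ k ≤ ‖d k‖) (hd' : ∀ k, ‖d k‖ ≤ Θ * r ^ k) (u : SkewTate δ r h) :
    ∃ f : ℕ × J → K, Tendsto f cofinite (𝓝 0) ∧
      HasSum (fun μ => f μ • (C (X μ.2) * (d μ.1)⁻¹ • (del : SkewTate δ r h) ^ μ.1)) u ∧
      ∀ μ, ‖f μ‖ ≤ Θ * C₀ * ‖u‖ := by
  have hr := h.pos
  have hd0 : ∀ k, d k ≠ 0 := fun k => norm_pos_iff.1 ((pow_pos hr k).trans_le (hd k))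
  choose f hf hsum hle using fun k => hexp (u.coeff k)
  have hbound : ∀ μ : ℕ × J, ‖d μ.1 * f μ.1 μ.2‖ ≤ Θ * C₀ * (‖u.coeff μ.1‖ * r ^ μ.1) := by
    intro μ
    rw [norm_mul]
    calc _ ≤ Θ * r ^ μ.1 * (C₀ * ‖u.coeff μ.1‖) :=
          mul_le_mul (hd' _) (hle _ _) (norm_nonneg _) (by positivity)
      _ = _ := by ring
  have hlim : Tendsto (fun μ : ℕ × J => d μ.1 * f μ.1 μ.2) cofinite (𝓝 0) := by
    rw [Metric.tendsto_nhds]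
    intro ε hε
    have h1 := u.tendsto_coeff.const_mul (Θ * C₀)
    rw [mul_zero] at h1
    obtain ⟨N, hN⟩ := eventually_atTop.1 (h1.eventually (gt_mem_nhds hε))
    have h2 : ∀ k, {α | ¬ dist (d k * f k α) 0 < ε}.Finite := fun k => by
      have h3 := (hf k).const_mul (d k)
      rw [mul_zero] at h3
      exact (Metric.tendsto_nhds.1 h3) ε hε
    rw [eventually_cofinite]
    -- Large degrees are uniformly small since `u` is a convergent series; each of the remaining
    -- finitely many degrees contributes finitely many exponents.
    refine ((Set.finite_lt_nat N).biUnion (t := fun k => (Prod.mk k) '' _)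
      fun k _ => (h2 k).image (Prod.mk k)).subset ?_
    rintro ⟨k, α⟩ hk
    simp only [Set.mem_iUnion]
    refine ⟨k, ?_, α, hk, rfl⟩
    by_contra hc
    refine hk ?_
    rw [dist_zero_right]
    exact (hbound (k, α)).trans_lt (hN k (not_lt.1 hc))
  have hmono : ∀ μ : ℕ × J, (d μ.1 * f μ.1 μ.2) •
      (C (X μ.2) * (d μ.1)⁻¹ • (del : SkewTate δ r h) ^ μ.1) =
        C (f μ.1 μ.2 • X μ.2) * del ^ μ.1 := by
    intro μ
    rw [mul_smul_comm, smul_smul, mul_assoc, mul_comm (f _ _), ← mul_assoc,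
      mul_inv_cancel₀ (hd0 _), one_mul, smul_eq, ← mul_assoc, ← map_mul, ← Algebra.smul_def]
  obtain ⟨Bc, hBc, hCB⟩ := exists_norm_C_le h
  have hsummable : Summable fun μ : ℕ × J => (d μ.1 * f μ.1 μ.2) •
      (C (X μ.2) * (d μ.1)⁻¹ • (del : SkewTate δ r h) ^ μ.1) := by
    refine MonomialFrame.summable_of_tendsto hlim (b := Bc * B * ‖(1 : SkewTate δ r h)‖)
      fun μ => ?_
    refine (norm_mul_le _ _).trans ?_
    refine mul_le_mul ((hCB _).trans (mul_le_mul_of_nonneg_left (hX _) hBc)) ?_ (norm_nonneg _)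
      (mul_nonneg hBc ((norm_nonneg _).trans (hX μ.2)))
    refine (norm_smul_le _ _).trans ?_
    rw [norm_inv, inv_mul_le_iff₀ (norm_pos_iff.2 (hd0 _))]
    exact (norm_del_pow_le _).trans (by gcongr; exact hd _)
  refine ⟨fun μ => d μ.1 * f μ.1 μ.2, hlim, ?_, fun μ => ?_⟩
  -- The double sum is evaluated degree by degree and compared with `∑ u_k ∂^k`.
  · convert hsummable.hasSum
    refine u.hasSum_coeff.unique (hsummable.hasSum.prod_fiberwise fun k => ?_)
    have h3 := ((hsum k).map (C : A →+* SkewTate δ r h) continuous_C).mul_right (del ^ k)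
    refine h3.congr_fun fun α => ?_
    exact hmono (k, α)
  · refine (hbound μ).trans ?_
    gcongr
    exact u.norm_coeff_le _

/-- The skew-Tate algebra over an affinoid algebra is left Noetherian. -/
theorem isNoetherianRing [CompleteSpace K] {p : ℕ} (hp : p.Prime) (hpK : ‖(p : K)‖ < 1)
    (hA : IsAffinoid K A) (hrK : ∃ n : ℕ, 0 < n ∧ ∃ c : K, c ≠ 0 ∧ r ^ n = ‖c‖)
    (h : IsAdmissible δ r) : IsNoetherianRing (SkewTate δ r h) := by
  have hr := h.pos
  obtain ⟨n, X, B, C₀, hC₀, hXadd, hXB, hexp⟩ := hA.exists_expansion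
  obtain ⟨n₀, hn₀, c₀, hc₀, hrc₀⟩ := hrK
  obtain ⟨ϖ, hϖ⟩ := NormedField.exists_one_lt_norm K
  obtain ⟨Bc, hBc, hCB⟩ := exists_norm_C_le h
  have hB : 0 ≤ B := (norm_nonneg _).trans (hXB 0)
  have hCX : ∀ α, ‖(C (X α) : SkewTate δ r h)‖ ≤ Bc * B := fun α =>
    (hCB _).trans (mul_le_mul_of_nonneg_left (hXB α) hBc)
  set E := Bc * B * (Bc * B) * ‖(1 : SkewTate δ r h)‖ with hE
  have hE0 : 0 ≤ E := by positivity
  have hL0 : 0 ≤ ‖ϖ‖ * C₀ := by positivity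
  -- The frame will have lift bound `‖ϖ‖ * C₀` and error `E * η`; this choice makes their product
  -- less than 1.
  set η := (‖ϖ‖ * C₀ * E + 1)⁻¹ with hη
  have hη0 : 0 < η := by positivity
  obtain ⟨k₀, hk₀⟩ := exists_small_commutator hp hpK h hη0
  -- The factor `p ^ k₀` makes `∂^q` almost central, and `n₀` puts `r ^ q` in the value group.
  set q := n₀ * p ^ k₀ with hq
  have hq0 : 0 < q := Nat.mul_pos hn₀ (pow_pos hp.pos _)
  have hrq : r ^ q = ‖c₀ ^ p ^ k₀‖ := by rw [hq, pow_mul, hrc₀, norm_pow]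
  set c := c₀ ^ p ^ k₀ with hc
  have hc0 : c ≠ 0 := pow_ne_zero _ hc₀
  obtain ⟨d, hd1, hd2, hdq⟩ := exists_scalar_sequence hϖ hr hq0 hrq
  have hd0 : ∀ k, d k ≠ 0 := fun k => norm_pos_iff.1 ((pow_pos hr k).trans_le (hd1 k))
  have hcomm : ∀ t (a : A), ‖(del : SkewTate δ r h) ^ (q * t) * C a - C a * del ^ (q * t)‖ ≤
      η * r ^ (q * t) * ‖(C a : SkewTate δ r h)‖ := fun t a =>
    hk₀ _ (Dvd.dvd.mul_right (Dvd.intro_left n₀ rfl) t) a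
  -- Any monomial order would serve: only well-foundedness, injectivity and compatibility with
  -- addition are used.
  let lex : MonomialOrder (Fin (n + 1)) := MonomialOrder.lex
  let M : MonomialFrame K (SkewTate δ r h) (ℕ × (Fin n →₀ ℕ)) (ℕ × (Fin n →₀ ℕ)) lex.syn :=
    { mono := fun μ => C (X μ.2) * (d μ.1)⁻¹ • del ^ μ.1
      act := fun g => C (X g.2) * (c ^ g.1)⁻¹ • del ^ (q * g.1)
      shift := fun g μ => (μ.1 + q * g.1, μ.2 + g.2)
      rank := fun μ => lex.toSyn (Finsupp.cons μ.1 μ.2)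
      monoBound := Bc * B * ‖(1 : SkewTate δ r h)‖
      actBound := Bc * B * ‖(1 : SkewTate δ r h)‖
      liftBound := ‖ϖ‖ * C₀
      error := E * η
      rank_injective := fun μ ν hμν => by
        have h1 := lex.toSyn.injective hμν
        exact Prod.ext (by simpa using DFunLike.congr_fun h1 0)
          (by simpa using congrArg Finsupp.tail h1)
      rank_shift := fun g μ ν hlt => by
        simp only [← cons_add_cons, map_add] at hlt ⊢
        gcongr
      norm_mono_le := fun μ => by
        refine (norm_mul_le _ _).trans (mul_le_mul (hCX _) ?_ (norm_nonneg _) (by positivity))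
        refine (norm_smul_le _ _).trans ?_
        rw [norm_inv, inv_mul_le_iff₀ (norm_pos_iff.2 (hd0 _))]
        exact (norm_del_pow_le _).trans (by gcongr; exact hd1 _)
      norm_act_le := fun g => by
        refine (norm_mul_le _ _).trans (mul_le_mul (hCX _) ?_ (norm_nonneg _) (by positivity))
        refine (norm_smul_le _ _).trans ?_
        rw [norm_inv, inv_mul_le_iff₀ (norm_pos_iff.2 (pow_ne_zero _ hc0)), norm_pow c, ← hrq,
          ← pow_mul]
        exact norm_del_pow_le _
      liftBound_nonneg := hL0
      error_nonneg := by positivity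
      liftBound_mul_error_lt := by
        rw [← mul_assoc, hη, ← div_eq_mul_inv, div_lt_one (by positivity)]
        linarith
      exists_lift := exists_expansion hC₀ (norm_nonneg _) hXB hexp hd1 hd2
      norm_act_mul_sub_le := fun g μ => by
        -- As `d (k + q * t) = c ^ t * d k` exactly, the scalars match and only the commutator of
        -- `∂^(qt)` with a constant remains.
        have h1 : C (X g.2) * (c ^ g.1)⁻¹ • del ^ (q * g.1) *
            (C (X μ.2) * (d μ.1)⁻¹ • del ^ μ.1) -
            C (X (μ.2 + g.2)) * (d (μ.1 + q * g.1))⁻¹ • del ^ (μ.1 + q * g.1) =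
            (d (μ.1 + q * g.1))⁻¹ • (C (X g.2) *
              ((del : SkewTate δ r h) ^ (q * g.1) * C (X μ.2) - C (X μ.2) * del ^ (q * g.1)) *
                del ^ μ.1) := by
          rw [hdq, add_comm μ.2, hXadd, map_mul, add_comm μ.1, pow_add, mul_inv]
          simp only [mul_smul_comm, smul_mul_assoc, smul_smul, mul_sub, sub_mul, smul_sub,
            mul_assoc]
          rw [mul_comm (d μ.1)⁻¹]
        rw [h1]
        refine (norm_smul_le _ _).trans ?_
        rw [norm_inv, inv_mul_le_iff₀ (norm_pos_iff.2 (hd0 _))]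
        have h2 := hcomm g.1 (X μ.2)
        calc _ ≤ ‖(C (X g.2) : SkewTate δ r h)‖ *
              ‖(del : SkewTate δ r h) ^ (q * g.1) * C (X μ.2) - C (X μ.2) * del ^ (q * g.1)‖ *
                ‖(del : SkewTate δ r h) ^ μ.1‖ :=
              (norm_mul_le _ _).trans (by gcongr; exact norm_mul_le _ _)
          _ ≤ Bc * B * (η * r ^ (q * g.1) * (Bc * B)) *
                (r ^ μ.1 * ‖(1 : SkewTate δ r h)‖) := by
              gcongr
              · exact hCX _
              · exact h2.trans (by gcongr; exact hCX _)
              · exact norm_del_pow_le _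
          _ = r ^ (μ.1 + q * g.1) * (E * η) := by rw [hE, pow_add]; ring
          _ ≤ _ := by gcongr; exact hd1 _
      exists_finite_basis := exists_finite_basis_shift hq0 }
  exact M.isNoetherianRing

/-- The skew-Tate algebra over an affinoid algebra is right Noetherian. -/
theorem isNoetherianRing_op [CompleteSpace K] {p : ℕ} (hp : p.Prime) (hpK : ‖(p : K)‖ < 1)
    (hA : IsAffinoid K A) (hrK : ∃ n : ℕ, 0 < n ∧ ∃ c : K, c ≠ 0 ∧ r ^ n = ‖c‖)
    (h : IsAdmissible δ r) : IsNoetherianRing (SkewTate δ r h)ᵐᵒᵖ := by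
  have := isNoetherianRing hp hpK hA hrK h.neg
  exact isNoetherianRing_of_surjective _ _ (reverseRingHom h) reverseRingHom_surjective

end SkewTate

end

end RigidLine

theorem mainTheorem10 (p : ℕ) [Fact p.Prime]
    (K : Type u) [NontriviallyNormedField K] [CompleteSpace K] [IsUltrametricDist K]
    (hp : ‖(p : K)‖ = (p : ℝ)⁻¹)
    (A : Type u) [NormedCommRing A] [NormedAlgebra K A] [CompleteSpace A] [IsUltrametricDist A]
    (x : A) (hX : RigidLine.IsAffinoidSubdomain K x)
    (r : ℝ) (hr : r ∈ RigidLine.sqrtValueGroup K)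
    (hrX : RigidLine.radius hX < ENNReal.ofReal r) :
    IsNoetherianRing (RigidLine.DiffOp hX r hrX) ∧
      IsNoetherianRing (RigidLine.DiffOp hX r hrX)ᵐᵒᵖ := by
  have hpp : p.Prime := Fact.out
  have hpK : ‖(p : K)‖ < 1 := by
    rw [hp]
    exact inv_lt_one_of_one_lt₀ (by exact_mod_cast hpp.one_lt)
  have hadm := RigidLine.isAdmissible_ddx hX hrX
  exact ⟨RigidLine.SkewTate.isNoetherianRing hpp hpK hX.1 hr.2 hadm,
    RigidLine.SkewTate.isNoetherianRing_op hpp hpK hX.1 hr.2 hadm⟩
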